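/- **Setting.** Let $p\ge 1$, let $K\ge 0$ be an integer, let $d\ge 1$, let $\Omega\subset\mathbb R^d$ be a compact set that contains a nondegenerate line segment, and let $z\in\mathbb R^d\setminus\Omega$. Let $n\ge 1+2\sum_{i=0}^{K}4^i$, and let $G_{\le n}(\Omega)$ be the set of nonempty finite simple graphs $G=(V,E,(x_v)_{v\in V})$ with at most $n$ nodes and node features $x_v\in\Omega$. Write $\mathcal N_v$ for the set of neighbors of $v$. **Tree Mover's Distance.** For a distance function $D$ and multisets $S,T$ with at most $n$ elements, let $W_D^{(\zeta)}(S,T)=\min_{\tau\in S_n}\sum_{j=1}^n D(s_j,t_{\tau(j)})$, where $s_1,\dots,s_n$ and $t_1,\dots,t_n$ enumerate $S$ and $T$ after each has been filled up to $n$ elements with copies of $\zeta$. The depth-$0$ computation tree $T_v^{(0)}$ of a node $v$ is a single node with feature $x_v$; the tree $T_v^{(k+1)}$ has a root with feature $x_v$ whose multiset of child subtrees is $\{\!\{T_u^{(k)}: u\in\mathcal N_v\}\!\}$. For trees $T_a,T_b$ with root features $x_a,x_b$ and multisets of child subtrees $\mathcal T_a,\mathcal T_b$, define recursively $TD(T_a,T_b)=\|x_a-x_b\|_p+W_{TD}^{(\bar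 T_z)}(\mathcal T_a,\mathcal T_b)$, where $\bar T_z$ is the one-node tree with feature $z$ and the second summand is absent if both trees are single nodes. Put $TMD^{(K)}(G,H)=W_{TD}^{(\bar T_z)}\big(\{\!\{T_v^{(K)}\}\!\}_{v\in V_G},\{\!\{T_v^{(K)}\}\!\}_{v\in V_H}\big)$. **Networks.** Fix feature dimensions $d=d_0,d_1,\dots,d_K\ge 1$, widths $W_1,\dots,W_{K+1}\ge 1$, a real $B>0$ and an activation $\sigma:\mathbb R\to\mathbb R$. For a multiset $\{\!\{x_1,\dots,x_r\}\!\}$ of vectors let $m_\sigma(\{\!\{x_1,\dots,x_r\}\!\};a,b)=\sum_{i=1}^r\sigma(a\cdot x_i-b)$. The MPNN of depth $K$ with activation $\sigma$ starts with $x_v^{(0)}=x_v$ and for $k=1,\dots,K$ sets $$c_{v,i}^{(k)}=m_\sigma\big(\{\!\{x_u^{(k-1)}:u\in\mathcal N_v\}\!\};a_i^{(k)},b_i^{(k)}\big)\ (1\le i\le W_k),\qquad x_v^{(k)}=A^{(k)}x_v^{(k-1)}+C^{(k)}c_v^{(k)}\in\mathbb R^{d_k}.$$ Its output $f(G;w)\in\mathbb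 R^{W_{K+1}}$ has the entries $m_\sigma\big(\{\!\{x_v^{(K)}:v\in V\}\!\};a_i^{(K+1)},b_i^{(K+1)}\big)$, $1\le i\le W_{K+1}$. The parameter vector $w$ is random with independent components: each $a_i^{(k)}$ is uniform on the unit sphere of $\mathbb R^{d_{k-1}}$, each $b_i^{(k)}$ is uniform on $[-B,B]$, and each row of the block matrix $[A^{(k)}\,|\,C^{(k)}]$ is uniform on the unit sphere of $\mathbb R^{d_{k-1}+W_k}$. It is called ReluMPNN if $\sigma(t)=\mathrm{ReLU}(t)=\max(t,0)$, and SmoothMPNN if $\sigma$ is smooth (being twice continuously differentiable suffices below). For $\alpha>0$, the network $f$ is called *$\alpha$ lower-Hölder in expectation with respect to $TMD^{(K)}$* if there is a constant $c>0$ such that $$c^p\le \mathbb E_w\left\{\frac{\|f(G;w)-f(H;w)\|_p}{TMD^{(K)}(G,H)^\alpha}\right\}^p\qquad\text{for all } G,H\in G_{\le n}(\Omega)\text{ with }TMD^{(K)}(G,H)>0.$$ **Theorem.** Let $\alpha>0$. 1. If ReluMPNN of depth $K$ is $\alpha$ lower-Hölder in expectation with respect to $TMD^{(K)}$, then $\alpha\ge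 1+\frac{K+1}{p}$. 2. If SmoothMPNN of depth $K$ is $\alpha$ lower-Hölder in expectation with respect to $TMD^{(K)}$, then $\alpha\ge 2^{K+1}$. -/

import Mathlib

open MeasureTheory

noncomputable section

/-! ### Lower-Hölder stability in expectation -/

/-- `f : X × P → Y`, with random parameter `w ∼ μ`, is `α` lower-Hölder in expectation with respect
to the (pseudo-)distances `dX` and `dY` and the integrability exponent `p`. The expectation of the
nonnegative random variable is a Lebesgue integral with values in `[0, ∞]`. -/
def LowerHolderInExpectation {X Y P : Type*} [MeasurableSpace P] (p α : ℝ)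
    (dX : X → X → ℝ) (dY : Y → Y → ℝ) (μ : Measure P) (f : X → P → Y) : Prop :=
  ∃ c : ℝ, 0 < c ∧ ∀ x x' : X, 0 < dX x x' →
    ENNReal.ofReal (c ^ p) ≤
      ∫⁻ w, ENNReal.ofReal ((dY (f x w) (f x' w) / dX x x' ^ α) ^ p) ∂μ

/-! ### Vectors, `ℓ_p` distances, uniform distributions -/

/-- Feature vectors in `ℝ^d`. -/
abbrev Vec (d : ℕ) : Type := EuclideanSpace ℝ (Fin d)

/-- The distance `‖x - y‖_p` of two real vectors indexed by a finite type. -/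
def lpDist {ι : Type*} [Fintype ι] (p : ℝ) (x y : ι → ℝ) : ℝ :=
  (∑ i, |x i - y i| ^ p) ^ (1 / p)

/-- The Euclidean unit sphere of `ℝ^ι`. -/
abbrev USphere (ι : Type) [Fintype ι] : Type :=
  Metric.sphere (0 : EuclideanSpace ℝ ι) 1

/-- The uniform probability distribution on the unit sphere: normalized surface measure. -/
def unifSphere (ι : Type) [Fintype ι] : Measure (USphere ι) :=
  ((volume : Measure (EuclideanSpace ℝ ι)).toSphere Set.univ)⁻¹ •
    (volume : Measure (EuclideanSpace ℝ ι)).toSphere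

/-- The uniform probability distribution on the interval `[-B, B]`. -/
def unifInterval (B : ℝ) : Measure ℝ :=
  (volume (Set.Icc (-B) B))⁻¹ • volume.restrict (Set.Icc (-B) B)

/-! ### Graphs with node features -/

/-- A finite simple graph on the nodes `0, …, numNodes - 1` with node features in `ℝ^d`. -/
structure FeatGraph (d : ℕ) where
  numNodes : ℕ
  graph : SimpleGraph (Fin numNodes)
  feat : Fin numNodes → Vec d

namespace FeatGraph

variable {d : ℕ}

/-- The multiset `{{ f u | u ∈ N_v }}` over the neighbors of `v`. -/
def overNbrs {X : Type*} (G : FeatGraph d) (f : Fin G.numNodes → X) (v : Fin G.numNodes) :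
    Multiset X :=
  open Classical in (Finset.univ.filter fun u => G.graph.Adj v u).val.map f

/-- The multiset `{{ f v | v ∈ V }}` over all nodes. -/
def overNodes {X : Type*} (G : FeatGraph d) (f : Fin G.numNodes → X) : Multiset X :=
  (Finset.univ : Finset (Fin G.numNodes)).val.map f

end FeatGraph

/-- The space `G_{≤ n}(Ω)` of (nonempty) graphs with at most `n` nodes and node features in `Ω`. -/
def BoundedGraphs {d : ℕ} (n : ℕ) (Ω : Set (Vec d)) : Type :=
  {G : FeatGraph d // 1 ≤ G.numNodes ∧ G.numNodes ≤ n ∧ ∀ v, G.feat v ∈ Ω}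

/-! ### The augmented Wasserstein distance -/

/-- The augmentation `ρ_(z)`: an enumeration `x_1, …, x_n` of the multiset `S` (with at most `n`
elements) filled up with copies of `z`. -/
def augment {X : Type*} (n : ℕ) (z : X) (S : Multiset X) (j : Fin n) : X :=
  S.toList.getD j z

/-- The augmented Wasserstein distance of two multisets with at most `n` elements: the minimum over
`τ ∈ S_n` of `∑ j, D (x_j) (y_{τ j})`, where `x`, `y` enumerate the multisets augmented by `z`. -/
def augWasserstein {X : Type*} (n : ℕ) (D : X → X → ℝ) (z : X) (S T : Multiset X) : ℝ :=
  ⨅ τ : Equiv.Perm (Fin n), ∑ j, D (augment n z S j) (augment n z T (τ j))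

/-- The family `augment n z S` enumerates `S` together with `n - |S|` copies of `z`. -/
theorem augment_spec {X : Type*} (n : ℕ) (z : X) (S : Multiset X) (hS : S.card ≤ n) :
    (Finset.univ : Finset (Fin n)).val.map (augment n z S) =
      S + Multiset.replicate (n - S.card) z := by
  have h1 : List.ofFn (augment n z S) = S.toList ++ List.replicate (n - S.card) z := by
    apply List.ext_getElem
    · simp; omega
    · intro i h2 h3
      simp only [List.getElem_ofFn, augment]
      by_cases h : i < S.toList.length
      · rw [List.getElem_append_left h, List.getD_eq_getElem _ _ h]
      · rw [List.getElem_append_right (by omega), List.getD_eq_default _ _ (by omega)]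
        simp
  have h2 : (Finset.univ : Finset (Fin n)).val.map (augment n z S) =
      (List.ofFn (augment n z S) : Multiset X) := by
    simp [Fin.univ_val_map]
  rw [h2, h1, ← Multiset.coe_add, Multiset.coe_toList, Multiset.coe_replicate]

/-! ### Computation trees and the Tree Mover's Distance -/

/-- Rooted unordered trees of depth at most `k` with node features in `ℝ^d`: a root feature together
with the multiset of the subtrees rooted at the children of the root. -/
def CompTree (d : ℕ) : ℕ → Type
  | 0 => Vec d
  | k + 1 => Vec d × Multiset (CompTree d k)

/-- The blank tree: a single node with feature `z`. -/
def blankTree {d : ℕ} (z : Vec d) : (k : ℕ) → CompTree d k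
  | 0 => z
  | _ + 1 => (z, 0)

/-- The depth-`k` computation tree `T_v^(k)` of the node `v`. -/
def compTree {d : ℕ} (G : FeatGraph d) : (k : ℕ) → Fin G.numNodes → CompTree d k
  | 0 => fun v => G.feat v
  | k + 1 => fun v => (G.feat v, G.overNbrs (compTree G k) v)

/-- The tree distance `TD`. Multisets of subtrees are augmented by blank trees to size `n`. -/
def treeDist {d : ℕ} (p : ℝ) (n : ℕ) (z : Vec d) : (k : ℕ) → CompTree d k → CompTree d k → ℝ
  | 0 => fun (S T : Vec d) => lpDist p S T
  | k + 1 => fun (S T : Vec d × Multiset (CompTree d k)) =>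
      lpDist p S.1 T.1 + augWasserstein n (treeDist p n z k) (blankTree z k) S.2 T.2

/-- The Tree Mover's Distance `TMD^(K)` on graphs with at most `n` nodes. -/
def TMD {d : ℕ} (p : ℝ) (n : ℕ) (z : Vec d) (K : ℕ) (G H : FeatGraph d) : ℝ :=
  augWasserstein n (treeDist p n z K) (blankTree z K)
    (G.overNodes (compTree G K)) (H.overNodes (compTree H K))

/-! ### Message passing neural networks with sum aggregation -/

/-- The multiset function `m_σ({{x_1, …, x_r}}; a, b) = ∑ i, σ (a ⬝ x_i - b)`. -/
def sumAct {d : ℕ} (σ : ℝ → ℝ) (S : Multiset (Vec d)) (ab : USphere (Fin d) × ℝ) : ℝ :=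
  (S.map fun x => σ ((∑ j, ab.1.1 j * x j) - ab.2)).sum

/-- Parameters of `W` parallel copies of `m_σ` on multisets in `ℝ^d`. -/
abbrev SumParams (d W : ℕ) : Type := Fin W → USphere (Fin d) × ℝ

/-- Independent copies with `a ∼ S^(d-1)` and `b ∼ [-B, B]`. -/
def sumParamsMeasure (d W : ℕ) (B : ℝ) : Measure (SumParams d W) :=
  Measure.pi fun _ => (unifSphere (Fin d)).prod (unifInterval B)

/-- Parameters of the linear COMBINE function `(x, c) ↦ A x + C c` from `ℝ^d × ℝ^W` to `ℝ^d'`: the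
rows of the block matrix `[A | C]`, each of which is a unit vector. -/
abbrev CombineParams (d W d' : ℕ) : Type := Fin d' → USphere (Fin d ⊕ Fin W)

/-- Independent rows, uniform on the unit sphere of `ℝ^(d + W)`. -/
def combineParamsMeasure (d W d' : ℕ) : Measure (CombineParams d W d') :=
  Measure.pi fun _ => unifSphere (Fin d ⊕ Fin W)

/-- The linear COMBINE function `A x + C c`. -/
def combine {d W d' : ℕ} (θ : CombineParams d W d') (x : Vec d) (c : Fin W → ℝ) : Vec d' :=
  WithLp.toLp 2 fun i =>
    ∑ j, (θ i).1 (Sum.inl j) * x j + ∑ l, (θ i).1 (Sum.inr l) * c l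

/-- Parameters of an MPNN of depth `K`: layer `k + 1` maps node features in `ℝ^(D k)` to node
features in `ℝ^(D (k+1))` using `W k` copies of `m_σ`, and READOUT uses `W K` copies of `m_σ` on
multisets in `ℝ^(D K)`. -/
abbrev MPNNParams (K : ℕ) (D W : ℕ → ℕ) : Type :=
  (∀ k : Fin K, SumParams (D k) (W k) × CombineParams (D k) (W k) (D (k + 1))) ×
    SumParams (D K) (W K)

/-- All parameters are drawn independently. -/
def mpnnMeasure (K : ℕ) (D W : ℕ → ℕ) (B : ℝ) : Measure (MPNNParams K D W) :=
  (Measure.pi fun k : Fin K =>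
      (sumParamsMeasure (D k) (W k) B).prod (combineParamsMeasure (D k) (W k) (D (k + 1)))).prod
    (sumParamsMeasure (D K) (W K) B)

/-- The node features `x_v^(k)` after `k ≤ K` message passing layers. -/
def nodeFeat {K : ℕ} {D W : ℕ → ℕ} (σ : ℝ → ℝ) (G : FeatGraph (D 0)) (w : MPNNParams K D W) :
    (k : ℕ) → k ≤ K → Fin G.numNodes → Vec (D k)
  | 0, _ => G.feat
  | k + 1, h => fun v =>
      combine (w.1 ⟨k, h⟩).2 (nodeFeat σ G w k (Nat.le_of_succ_le h) v) fun i =>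
        sumAct σ (G.overNbrs (nodeFeat σ G w k (Nat.le_of_succ_le h)) v) ((w.1 ⟨k, h⟩).1 i)

/-- The graph embedding `c^global ∈ ℝ^(W K)` of the MPNN of depth `K` with activation `σ`. -/
def mpnn {K : ℕ} {D W : ℕ → ℕ} (σ : ℝ → ℝ) (G : FeatGraph (D 0)) (w : MPNNParams K D W) :
    Fin (W K) → ℝ :=
  fun i => sumAct σ (G.overNodes (nodeFeat σ G w K le_rfl)) (w.2 i)

/-- The activation `ReLU`. -/
def relu (t : ℝ) : ℝ := max t 0

/-- The MPNN of depth `K` with activation `σ`, as a parametric function on `G_{≤ n}(Ω)`, is `α`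
lower-Hölder in expectation with respect to `TMD^(K)`. -/
def MPNNLowerHolder (p α : ℝ) (K n : ℕ) (D W : ℕ → ℕ) (B : ℝ) (Ω : Set (Vec (D 0)))
    (z : Vec (D 0)) (σ : ℝ → ℝ) : Prop :=
  LowerHolderInExpectation p α
    (fun G H : BoundedGraphs n Ω => TMD p n z K G.1 H.1)
    (lpDist p)
    (mpnnMeasure K D W B)
    (fun (G : BoundedGraphs n Ω) (w : MPNNParams K D W) => mpnn σ G.1 w)

end

/-!
For each small `ε` a pair of graphs is constructed which has Tree Mover's Distance at least of order
`ε` but on which the network outputs are nearly always, or always, much closer than that.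

**The graphs.** Both graphs have the same nodes: eight on each level `0, …, K - 1` and two on level
`K`. On each level there are "plus", "minus" and "neutral" nodes. The leaves (level `0`) carry the
features `x₀ + e`, `x₀ - e` and `x₀` respectively, with `e` of size `ε`; all other nodes carry `x₀`.
A plus node is joined to two plus and two minus nodes on the level below, a minus node to four
neutral nodes, a neutral node to one plus, one minus and two neutral nodes. The two graphs differ
only in the top nodes: a plus and a minus node in the first graph, two neutral nodes in the second.

**Message passing.** Information from the leaves needs `l` rounds to reach level `l`. Hence before
round `l` all nodes on level `l` have the same value (`LayeredScheme.exists_const`), in round `l`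
the value is determined by the children (`LayeredScheme.exists_step`), and during all `K` rounds
the nodes below the top level cannot see how the top nodes are wired (`LayeredScheme.inl_eq`). This
holds for every message passing scheme, and it is used twice.

For computation trees it yields a function which is `1`-Lipschitz for the tree distance and vanishes
on neutral top nodes but not on plus and minus ones (`exists_lipschitz_compTree`); by the easy half
of Kantorovich duality the Tree Mover's Distance is at least of order `ε`
(`le_TMD_layeredFeatGraph`).

For the network it shows that in round `l` the features on level `l` are `m + δ`, `m - δ` and `m` at
the plus, minus and neutral nodes, where the next `δ` is a linear image of the second differences
`σ (t + h) + σ (t - h) - 2 σ t` with `t = a ⬝ m - b` and `h = a ⬝ δ`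
(`nodeFeat_eq_center_add_spread`). The difference of the outputs is such a second difference, too
(`mpnn_sub_mpnn_eq_secDiff`).

**The exponents.** If `σ` is twice continuously differentiable, the second difference is of order
`h ^ 2`, so that each of the `K + 1` layers squares the size of `δ`, and the outputs differ by at
most a constant times `ε ^ 2 ^ (K + 1)`. For `relu` it is of order `h`, and zero unless the kink is
within `|h|` of `t`. So the outputs differ by at most a constant times `ε`, and they are different
only if in each of the `K + 1` layers a bias falls into an interval of length of order `ε` that is
determined by the other parameters of the layer and by the previous layers; the probability of this
is of order `ε ^ (K + 1)` (`mpnnMeasure_kinks_le`). Letting `ε` tend to zero gives the bounds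
(`LowerHolderInExpectation.add_div_le`).
-/

/-! ### Layered graphs -/

/-- The nodes of the layered graphs: eight nodes on each of the levels `0, …, K - 1`, and two top
nodes on level `K`. -/
abbrev LayerNode (K : ℕ) : Type := (Fin K × Fin 8) ⊕ Fin 2

/-- The wiring of a node to the eight nodes on the level below, which depends on its pattern.
Patterns `0, 1` ("plus") use all of `0, 1, 2, 3`; patterns `2, 3` ("minus") use all of `4, …, 7`;
the "neutral" patterns `4, …, 7` use one plus node, one minus node and two neutral nodes. Each
pattern has exactly four children, and each node below is a child of exactly four of the eight
patterns. -/
def childSet : Fin 8 → Finset (Fin 8) :=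
  ![{0, 1, 2, 3}, {0, 1, 2, 3}, {4, 5, 6, 7}, {4, 5, 6, 7},
    {0, 2, 4, 5}, {0, 2, 4, 5}, {1, 3, 6, 7}, {1, 3, 6, 7}]

/-- The sign of a pattern: `1` for plus, `-1` for minus, `0` for neutral. -/
noncomputable def patternSign : Fin 8 → ℝ := ![1, 1, -1, -1, 0, 0, 0, 0]

/-- The level of a node. -/
def LayerNode.level {K : ℕ} : LayerNode K → ℕ
  | Sum.inl x => x.1
  | Sum.inr _ => K

/-- The pattern of a node: nodes below the top level have their own index as their pattern, the
patterns of the top nodes are given by `q`. -/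
def LayerNode.pattern {K : ℕ} (q : Fin 2 → Fin 8) : LayerNode K → Fin 8
  | Sum.inl x => x.2
  | Sum.inr t => q t

@[simp] theorem LayerNode.level_inl {K : ℕ} (x : Fin K × Fin 8) :
    LayerNode.level (Sum.inl x : LayerNode K) = x.1 := rfl

@[simp] theorem LayerNode.level_inr {K : ℕ} (t : Fin 2) :
    LayerNode.level (Sum.inr t : LayerNode K) = K := rfl

@[simp] theorem LayerNode.pattern_inl {K : ℕ} (q : Fin 2 → Fin 8) (x : Fin K × Fin 8) :
    LayerNode.pattern q (Sum.inl x : LayerNode K) = x.2 := rfl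

@[simp] theorem LayerNode.pattern_inr {K : ℕ} (q : Fin 2 → Fin 8) (t : Fin 2) :
    LayerNode.pattern q (Sum.inr t : LayerNode K) = q t := rfl

/-- `u` is a child of `v`. -/
def IsChild {K : ℕ} (q : Fin 2 → Fin 8) (u v : LayerNode K) : Prop :=
  v.level = u.level + 1 ∧ u.pattern q ∈ childSet (v.pattern q)

/-- The patterns of the two top nodes are admissible if each node on the level below the top level
is a child of exactly one top node. -/
def AdmissibleTops (q : Fin 2 → Fin 8) : Prop :=
  ∀ j, (Finset.univ.filter fun t => j ∈ childSet (q t)).card = 1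

/-- The top patterns of the first graph: a plus and a minus node. -/
def splitTops : Fin 2 → Fin 8 := ![0, 2]

/-- The top patterns of the second graph: two neutral nodes. -/
def neutralTops : Fin 2 → Fin 8 := ![4, 6]

theorem admissibleTops_splitTops : AdmissibleTops splitTops := by
  unfold AdmissibleTops; decide

theorem admissibleTops_neutralTops : AdmissibleTops neutralTops := by
  unfold AdmissibleTops; decide

theorem card_childSet (p : Fin 8) : (childSet p).card = 4 := by
  revert p; decide

theorem card_filter_mem_childSet (j : Fin 8) :
    (Finset.univ.filter fun i => j ∈ childSet i).card = 4 := by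
  revert j; decide

theorem LayerNode.level_le {K : ℕ} (v : LayerNode K) : v.level ≤ K := by
  rcases v with x | t
  · exact x.1.2.le
  · exact le_rfl

/-- The layered graph: each node is joined to its children. -/
def layeredGraph {K : ℕ} (q : Fin 2 → Fin 8) : SimpleGraph (LayerNode K) where
  Adj u v := IsChild q u v ∨ IsChild q v u
  symm := ⟨fun _ _ h => h.symm⟩
  loopless := ⟨fun v h => by
    have : v.level = v.level + 1 := by rcases h with h | h <;> exact h.1
    omega⟩

open Classical in
/-- The multiset of the values of `f` on the neighbors of `v`. -/
noncomputable def layerNbrs {K : ℕ} {X : Type*} (q : Fin 2 → Fin 8) (f : LayerNode K → X)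
    (v : LayerNode K) : Multiset X :=
  ∑ u, if (layeredGraph q).Adj v u then {f u} else 0

/-- The number of parents of a node on level `l`. -/
def numParents (K l : ℕ) : ℕ := if l + 1 < K then 4 else if l + 1 = K then 1 else 0

theorem sum_ite_val_eq {K : ℕ} {M : Type*} [AddCommMonoid M] (m : ℕ) (g : Fin K → M) :
    (∑ l : Fin K, if (l : ℕ) = m then g l else 0) = if h : m < K then g ⟨m, h⟩ else 0 := by
  split_ifs with h
  · rw [Finset.sum_eq_single ⟨m, h⟩]
    · simp
    · intro b _ hb
      rw [if_neg]
      intro h'; exact hb (Fin.ext h')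
    · simp
  · apply Finset.sum_eq_zero
    intro l _
    rw [if_neg]
    intro h'; exact h (h' ▸ l.2)

section
open Classical

theorem layerNbrs_eq_parents_add_children {K : ℕ} {X : Type*} (q : Fin 2 → Fin 8)
    (f : LayerNode K → X) (v : LayerNode K) :
    layerNbrs q f v = (∑ u, if IsChild q v u then {f u} else 0) +
      ∑ u, if IsChild q u v then {f u} else 0 := by
  rw [layerNbrs, ← Finset.sum_add_distrib]
  refine Finset.sum_congr rfl fun u _ => ?_
  have hne : ¬ (IsChild q v u ∧ IsChild q u v) := fun h => by
    have h1 := h.1.1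
    have h2 := h.2.1
    omega
  by_cases h1 : IsChild q v u <;> by_cases h2 : IsChild q u v <;>
    simp_all [layeredGraph]

theorem sum_parents_eq {K : ℕ} {X : Type*} {q : Fin 2 → Fin 8} (hq : AdmissibleTops q)
    (f : LayerNode K → X) (v : LayerNode K) (a : X)
    (hf : ∀ u : LayerNode K, u.level = v.level + 1 → f u = a) :
    (∑ u, if IsChild q v u then ({f u} : Multiset X) else 0) = numParents K v.level • {a} := by
  have h1 : (∑ u, if IsChild q v u then ({f u} : Multiset X) else 0) =
      ∑ u : LayerNode K, if u.level = v.level + 1 then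
        (if v.pattern q ∈ childSet (u.pattern q) then ({a} : Multiset X) else 0) else 0 := by
    refine Finset.sum_congr rfl fun u _ => ?_
    by_cases h : u.level = v.level + 1
    · simp [IsChild, h, hf u h]
    · simp [IsChild, h]
  rw [h1, Fintype.sum_sum_type, Fintype.sum_prod_type]
  have h2 : ∀ l : Fin K, (∑ i : Fin 8, if (l : ℕ) = v.level + 1 then
      (if v.pattern q ∈ childSet i then ({a} : Multiset X) else 0) else 0) =
        if (l : ℕ) = v.level + 1 then 4 • {a} else 0 := by
    intro l
    by_cases h : (l : ℕ) = v.level + 1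
    · simp only [h, if_true]
      rw [← Finset.sum_filter, Finset.sum_const, card_filter_mem_childSet]
    · simp [h]
  have h3 : (∑ t : Fin 2, if K = v.level + 1 then (if v.pattern q ∈ childSet (q t) then
        ({a} : Multiset X) else 0) else 0) = if K = v.level + 1 then {a} else 0 := by
    by_cases h : K = v.level + 1
    · rw [if_pos h]
      simp only [if_pos h]
      rw [← Finset.sum_filter, Finset.sum_const, hq, one_smul]
    · simp [h]
  refine (congrArg₂ (· + ·) ((Finset.sum_congr rfl fun l _ => h2 l).trans (sum_ite_val_eq _ _))
    h3).trans ?_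
  rw [numParents]
  have := v.level_le
  split_ifs <;> first | omega | simp

theorem sum_children_eq {K : ℕ} {X : Type*} (q : Fin 2 → Fin 8)
    (f : LayerNode K → X) (v : LayerNode K) {l : ℕ} (hl : l < K) (hv : v.level = l + 1) :
    (∑ u, if IsChild q u v then ({f u} : Multiset X) else 0) =
      ∑ j ∈ childSet (v.pattern q), {f (Sum.inl (⟨l, hl⟩, j))} := by
  rw [Fintype.sum_sum_type, Fintype.sum_prod_type]
  have h3 : (∑ t : Fin 2, if IsChild q (Sum.inr t) v then
      ({f (Sum.inr t)} : Multiset X) else 0) = 0 := by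
    refine Finset.sum_eq_zero fun t _ => ?_
    rw [if_neg]
    intro h
    have h1 := h.1
    have h2 := v.level_le
    simp only [LayerNode.level_inr] at h1
    omega
  rw [h3, add_zero, Finset.sum_eq_single ⟨l, hl⟩]
  · have h4 : ∀ j, IsChild q (Sum.inl (⟨l, hl⟩, j)) v ↔ j ∈ childSet (v.pattern q) :=
      fun j => and_iff_right hv
    simp only [h4]
    rw [← Finset.sum_filter, Finset.filter_mem_eq_inter, Finset.univ_inter]
  · intro m _ hm
    refine Finset.sum_eq_zero fun j _ => ?_
    rw [if_neg]
    intro h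
    have h1 := h.1
    simp only [LayerNode.level_inl] at h1 hv
    exact hm (Fin.ext (by simp only; omega))
  · simp

/-- The neighborhood of a node below the top level does not depend on the wiring of the top nodes,
if `f` is constant on the top nodes. -/
theorem layerNbrs_inl_congr {K : ℕ} {X : Type*} {q q' : Fin 2 → Fin 8} (hq : AdmissibleTops q)
    (hq' : AdmissibleTops q') (f f' : LayerNode K → X) (x : Fin K × Fin 8) (a : X)
    (hf : ∀ u, f (Sum.inl u) = f' (Sum.inl u)) (ha : ∀ t, f (Sum.inr t) = a)
    (ha' : ∀ t, f' (Sum.inr t) = a) :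
    layerNbrs q f (Sum.inl x) = layerNbrs q' f' (Sum.inl x) := by
  have key : ∀ {q : Fin 2 → Fin 8} (_ : AdmissibleTops q), (∑ t : Fin 2,
      if (layeredGraph q).Adj (Sum.inl x) (Sum.inr t) then ({a} : Multiset X) else 0) =
      if K = x.1 + 1 then {a} else 0 := by
    intro q hq
    have h0 : ∀ t, (layeredGraph q).Adj (Sum.inl x) (Sum.inr t) ↔
        (K = x.1 + 1 ∧ x.2 ∈ childSet (q t)) := by
      intro t
      have := x.1.2
      simp only [layeredGraph, IsChild, LayerNode.level_inl, LayerNode.level_inr,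
        LayerNode.pattern_inl, LayerNode.pattern_inr]
      constructor
      · rintro (h | h)
        · exact h
        · omega
      · exact Or.inl
    simp only [h0]
    by_cases h : K = x.1 + 1
    · rw [if_pos h]
      have h1 : ∀ t, (K = x.1 + 1 ∧ x.2 ∈ childSet (q t)) ↔ x.2 ∈ childSet (q t) :=
        fun t => and_iff_right h
      simp only [h1]
      rw [← Finset.sum_filter, Finset.sum_const, hq, one_smul]
    · simp [h]
  unfold layerNbrs
  rw [Fintype.sum_sum_type, Fintype.sum_sum_type]
  congr 1
  · refine Finset.sum_congr rfl fun u _ => ?_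
    rw [hf]
    rfl
  · simp only [ha, ha', key hq, key hq']

end

/-! ### Message passing on layered graphs -/

section

variable {K : ℕ} {Y : ℕ → Type*}

/-- A message passing scheme with `K` rounds on all layered graphs at the same time: `y q k h v` is
the value at the node `v` after `k ≤ K` rounds in the graph with top patterns `q`. The initial
values depend only on the pattern on level `0`, and they are constant on each other level. -/
structure LayeredScheme (K : ℕ) (Y : ℕ → Type*)
    (y : (Fin 2 → Fin 8) → ∀ k, k ≤ K → LayerNode K → Y k) : Prop where
  zero_inl : ∀ q q' x, y q 0 (Nat.zero_le K) (Sum.inl x) = y q' 0 (Nat.zero_le K) (Sum.inl x)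
  zero_const : ∀ l, 0 < l → ∃ a, ∀ q, ∀ v : LayerNode K, v.level = l → y q 0 (Nat.zero_le K) v = a
  step : ∀ k (hk : k + 1 ≤ K), ∃ U : Y k → Multiset (Y k) → Y (k + 1), ∀ q v,
    y q (k + 1) hk v = U (y q k (Nat.le_of_succ_le hk) v)
      (layerNbrs q (y q k (Nat.le_of_succ_le hk)) v)

namespace LayeredScheme

variable {y : (Fin 2 → Fin 8) → ∀ k, k ≤ K → LayerNode K → Y k}

/-- Information from the leaves reaches level `l` only in round `l`: before, all nodes of a level
have the same value. -/
theorem exists_const (hy : LayeredScheme K Y y) {r : ℕ} (hr : r ≤ K) {l : ℕ} (hl : r < l) :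
    ∃ a, ∀ q, AdmissibleTops q → ∀ v : LayerNode K, v.level = l → y q r hr v = a := by
  induction r generalizing l with
  | zero =>
    obtain ⟨a, ha⟩ := hy.zero_const l hl
    exact ⟨a, fun q _ v hv => ha q v hv⟩
  | succ r ih =>
    obtain ⟨U, hU⟩ := hy.step r hr
    have hr' := Nat.le_of_succ_le hr
    obtain ⟨a, ha⟩ := ih hr' (l := l) (by omega)
    obtain ⟨b, hb⟩ := ih hr' (l := l + 1) (by omega)
    obtain ⟨c, hc⟩ := ih hr' (l := l - 1) (by omega)
    refine ⟨U a (numParents K l • {b} + 4 • {c}), fun q hq v hv => ?_⟩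
    have hlK : l - 1 < K := by
      have := v.level_le
      omega
    rw [hU, ha q hq v hv, layerNbrs_eq_parents_add_children,
      sum_parents_eq hq _ v b (fun u hu => hb q hq u (by omega)),
      sum_children_eq q _ v hlK (by omega), hv]
    congr 2
    rw [Finset.sum_congr rfl (g := fun _ => {c})]
    · rw [Finset.sum_const, card_childSet]
    · intro j _
      rw [hc q hq _ rfl]

/-- In round `l`, the value of a node on level `l` is determined by the values of its children. -/
theorem exists_step (hy : LayeredScheme K Y y) {r : ℕ} (hr : r + 1 ≤ K) :
    ∃ (a : Y r) (N : Multiset (Y r)), ∀ q, AdmissibleTops q → ∀ v : LayerNode K,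
      v.level = r + 1 → y q r (Nat.le_of_succ_le hr) v = a ∧
        layerNbrs q (y q r (Nat.le_of_succ_le hr)) v = N + ∑ j ∈ childSet (v.pattern q),
          {y q r (Nat.le_of_succ_le hr) (Sum.inl (⟨r, hr⟩, j))} := by
  have hr' := Nat.le_of_succ_le hr
  obtain ⟨a, ha⟩ := hy.exists_const hr' (l := r + 1) (by omega)
  obtain ⟨b, hb⟩ := hy.exists_const hr' (l := r + 2) (by omega)
  refine ⟨a, numParents K (r + 1) • {b}, fun q hq v hv => ⟨ha q hq v hv, ?_⟩⟩
  rw [layerNbrs_eq_parents_add_children,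
    sum_parents_eq hq _ v b (fun u hu => hb q hq u (by omega)),
    sum_children_eq q _ v hr hv, hv]

/-- Since the top nodes learn about the leaves only in round `K`, the values below the top level do
not depend on the wiring of the top nodes. -/
theorem inl_eq (hy : LayeredScheme K Y y) {r : ℕ} (hr : r ≤ K) {q q' : Fin 2 → Fin 8}
    (hq : AdmissibleTops q) (hq' : AdmissibleTops q') (x : Fin K × Fin 8) :
    y q r hr (Sum.inl x) = y q' r hr (Sum.inl x) := by
  induction r generalizing x with
  | zero => exact hy.zero_inl q q' x
  | succ r ih =>
    obtain ⟨U, hU⟩ := hy.step r hr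
    have hr' := Nat.le_of_succ_le hr
    obtain ⟨a, ha⟩ := hy.exists_const hr' (l := K) (by omega)
    rw [hU, hU, ih hr' x, layerNbrs_inl_congr hq hq' _ _ x a (ih hr')
      (fun t => ha q hq _ rfl) (fun t => ha q' hq' _ rfl)]

end LayeredScheme

end

/-! ### The adversarial pair of feature graphs -/

/-- An enumeration of the nodes of the layered graphs. -/
def layerEquiv (K : ℕ) : LayerNode K ≃ Fin (K * 8 + 2) :=
  (Equiv.sumCongr finProdFinEquiv (Equiv.refl _)).trans finSumFinEquiv

/-- The layered graph with node features: the leaves (level `0`) have the feature `x₀ ± e` or `x₀`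
according to the sign of their pattern, and all other nodes have the feature `x₀`. -/
noncomputable def layeredFeatGraph {d : ℕ} (K : ℕ) (x₀ e : Vec d) (q : Fin 2 → Fin 8) :
    FeatGraph d where
  numNodes := K * 8 + 2
  graph := (layeredGraph (K := K) q).comap (layerEquiv K).symm
  feat v := x₀ + (if ((layerEquiv K).symm v).level = 0 then
    patternSign (((layerEquiv K).symm v).pattern q) else 0) • e

/-- The index of a node of the layered graph in the layered feature graph. -/
def layerIdx {d K : ℕ} (x₀ e : Vec d) (q : Fin 2 → Fin 8) (v : LayerNode K) :
    Fin (layeredFeatGraph K x₀ e q).numNodes :=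
  layerEquiv K v

theorem overNbrs_layeredFeatGraph {d : ℕ} (K : ℕ) (x₀ e : Vec d) (q : Fin 2 → Fin 8) {X : Type*}
    (f : Fin (layeredFeatGraph K x₀ e q).numNodes → X) (v : LayerNode K) :
    (layeredFeatGraph K x₀ e q).overNbrs f (layerIdx x₀ e q v) =
      layerNbrs q (fun u => f (layerIdx x₀ e q u)) v := by
  classical
  have h1 : ∀ (f : Fin (K * 8 + 2) → X) (g : SimpleGraph (Fin (K * 8 + 2)))
      (v : Fin (K * 8 + 2)),
      (Finset.univ.filter fun u => g.Adj v u).val.map f = ∑ u, if g.Adj v u then {f u} else 0 := by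
    intro f g v
    rw [← Finset.sum_filter, Finset.sum, ← Multiset.sum_map_singleton (Multiset.map f _),
      Multiset.map_map]
    rfl
  refine Eq.trans ?_ ((h1 f ((layeredGraph (K := K) q).comap (layerEquiv K).symm)
    (layerEquiv K v)).trans ?_)
  · unfold FeatGraph.overNbrs
    congr
  · refine (Fintype.sum_equiv (layerEquiv K) _ _ fun u => ?_).symm
    simp only [SimpleGraph.comap_adj, Equiv.symm_apply_apply]
    rfl

theorem overNodes_layeredFeatGraph {d : ℕ} (K : ℕ) (x₀ e : Vec d) (q : Fin 2 → Fin 8) {X : Type*}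
    (f : Fin (layeredFeatGraph K x₀ e q).numNodes → X) (g : X → ℝ) :
    (((layeredFeatGraph K x₀ e q).overNodes f).map g).sum =
      (∑ x, g (f (layerIdx x₀ e q (Sum.inl x)))) + ∑ t, g (f (layerIdx x₀ e q (Sum.inr t))) := by
  have h1 : ((Finset.univ.val.map f).map g).sum = ∑ u, g (f u) := by
    rw [Multiset.map_map]
    rfl
  refine h1.trans (Eq.trans ?_ (Fintype.sum_sum_type
    (fun u => g (f (layerIdx x₀ e q u)))))
  exact (Fintype.sum_equiv (layerEquiv K) _ _ fun u => rfl).symm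

theorem feat_layeredFeatGraph {d : ℕ} (K : ℕ) (x₀ e : Vec d) (q : Fin 2 → Fin 8)
    (v : LayerNode K) :
    (layeredFeatGraph K x₀ e q).feat (layerIdx x₀ e q v) =
      x₀ + (if v.level = 0 then patternSign (v.pattern q) else 0) • e := by
  simp [layeredFeatGraph, layerIdx]

/-- Every message passing scheme on feature graphs restricts to a scheme on layered graphs. -/
theorem LayeredScheme.of_featGraph {d K : ℕ} {Y : ℕ → Type*}
    (y : ∀ (G : FeatGraph d) (k : ℕ), k ≤ K → Fin G.numNodes → Y k) (ι : Vec d → Y 0)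
    (h0 : ∀ G v, y G 0 (Nat.zero_le K) v = ι (G.feat v))
    (hstep : ∀ k (hk : k + 1 ≤ K), ∃ U : Y k → Multiset (Y k) → Y (k + 1), ∀ G v,
      y G (k + 1) hk v = U (y G k (Nat.le_of_succ_le hk) v)
        (G.overNbrs (y G k (Nat.le_of_succ_le hk)) v))
    (x₀ e : Vec d) :
    LayeredScheme K Y fun q k hk v => y (layeredFeatGraph K x₀ e q) k hk (layerIdx x₀ e q v) where
  zero_inl q q' x := by
    rw [h0, h0, feat_layeredFeatGraph, feat_layeredFeatGraph]
    simp
  zero_const l hl := by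
    refine ⟨ι x₀, fun q v hv => ?_⟩
    rw [h0, feat_layeredFeatGraph, if_neg (by omega), zero_smul, add_zero]
  step k hk := by
    obtain ⟨U, hU⟩ := hstep k hk
    refine ⟨U, fun q v => ?_⟩
    rw [hU]
    congr 1
    exact overNbrs_layeredFeatGraph K x₀ e q _ v

/-! ### A lower bound for the Tree Mover's Distance -/

theorem lpDist_nonneg {ι : Type*} [Fintype ι] (p : ℝ) (x y : ι → ℝ) : 0 ≤ lpDist p x y :=
  Real.rpow_nonneg (Finset.sum_nonneg fun _ _ => Real.rpow_nonneg (abs_nonneg _) _) _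

theorem abs_sub_le_lpDist {ι : Type*} [Fintype ι] {p : ℝ} (hp : 0 < p) (x y : ι → ℝ) (i : ι) :
    |x i - y i| ≤ lpDist p x y := by
  have h1 : |x i - y i| ^ p ≤ ∑ i, |x i - y i| ^ p :=
    Finset.single_le_sum (f := fun i => |x i - y i| ^ p)
      (fun _ _ => Real.rpow_nonneg (abs_nonneg _) _) (Finset.mem_univ i)
  have h2 := Real.rpow_le_rpow (Real.rpow_nonneg (abs_nonneg _) _) h1
    (one_div_nonneg.2 hp.le)
  rwa [← Real.rpow_mul (abs_nonneg _), mul_one_div_cancel hp.ne', Real.rpow_one] at h2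

/-- The easy half of Kantorovich duality. -/
theorem abs_sum_augment_sub_le_augWasserstein {X : Type*} (n : ℕ) {D : X → X → ℝ} (z : X)
    (S T : Multiset X) {ψ : X → ℝ} (hψ : ∀ a b, |ψ a - ψ b| ≤ D a b) :
    |(∑ j, ψ (augment n z S j)) - ∑ j, ψ (augment n z T j)| ≤ augWasserstein n D z S T := by
  refine le_ciInf fun τ => ?_
  rw [← Equiv.sum_comp τ (fun j => ψ (augment n z T j)), ← Finset.sum_sub_distrib]
  exact (Finset.abs_sum_le_sum_abs _ _).trans (Finset.sum_le_sum fun j _ => hψ _ _)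

theorem sum_augment {X : Type*} {n : ℕ} (z : X) {S : Multiset X} (hS : S.card ≤ n) (ψ : X → ℝ) :
    ∑ j, ψ (augment n z S j) = (S.map ψ).sum + (n - S.card : ℕ) * ψ z := by
  have h := congrArg (fun T : Multiset X => (T.map ψ).sum) (augment_spec n z S hS)
  simp only [Multiset.map_map, Multiset.map_add, Multiset.sum_add, Multiset.map_replicate,
    Multiset.sum_replicate, nsmul_eq_mul] at h
  exact h

theorem card_overNbrs_le {d : ℕ} (G : FeatGraph d) {X : Type*} (f : Fin G.numNodes → X)
    (v : Fin G.numNodes) : (G.overNbrs f v).card ≤ G.numNodes := by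
  classical
  unfold FeatGraph.overNbrs
  rw [Multiset.card_map]
  exact (Finset.card_le_univ _).trans (Fintype.card_fin _).le

theorem sum_abs_patternSign (p : Fin 8) :
    ∑ j ∈ childSet p, |patternSign j| = 2 + 2 * patternSign p := by
  fin_cases p <;> simp [childSet, patternSign] <;> norm_num

/-- The root feature of a computation tree. -/
def rootFeat {d : ℕ} : (k : ℕ) → CompTree d k → Vec d
  | 0 => id
  | _ + 1 => Prod.fst

theorem rootFeat_compTree {d : ℕ} (G : FeatGraph d) (k : ℕ) (v : Fin G.numNodes) :
    rootFeat k (compTree G k v) = G.feat v := by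
  cases k <;> rfl

theorem layeredScheme_compTree {d : ℕ} (K : ℕ) (x₀ e : Vec d) :
    LayeredScheme K (CompTree d)
      fun q k _ v => compTree (layeredFeatGraph K x₀ e q) k (layerIdx x₀ e q v) :=
  LayeredScheme.of_featGraph (fun G k _ => compTree G k) id (fun _ _ => rfl)
    (fun k _ => ⟨fun T S => (rootFeat k T, S), fun G v =>
      congrArg (fun x => (x, G.overNbrs (compTree G k) v)) (rootFeat_compTree G k v).symm⟩) x₀ e

/-- There is a function of computation trees, `1`-Lipschitz with respect to the tree distance,
which in round `l` tells the neutral nodes on level `l` from the others. -/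
theorem exists_lipschitz_compTree {d : ℕ} {p : ℝ} (hp : 0 < p) {K n : ℕ} (hn : K * 8 + 2 ≤ n)
    (z x₀ e : Vec d) (i : Fin d) {l : ℕ} (hl : l ≤ K) :
    ∃ ψ : CompTree d l → ℝ, (∀ S T, |ψ S - ψ T| ≤ treeDist p n z l S T) ∧
      ∀ q, AdmissibleTops q → ∀ v : LayerNode K, v.level = l →
        ψ (compTree (layeredFeatGraph K x₀ e q) l (layerIdx x₀ e q v)) =
          2 ^ l * |e i| * |patternSign (v.pattern q)| := by
  induction l with
  | zero =>
    refine ⟨fun x : Vec d => |x i - x₀ i|, fun S T => ?_, fun q _ v hv => ?_⟩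
    · refine (abs_abs_sub_abs_le_abs_sub _ _).trans ?_
      rw [sub_sub_sub_cancel_right]
      exact abs_sub_le_lpDist hp (WithLp.ofLp (p := 2) (S : Vec d))
        (WithLp.ofLp (p := 2) (T : Vec d)) i
    · have h := feat_layeredFeatGraph K x₀ e q v
      rw [if_pos hv] at h
      change |(layeredFeatGraph K x₀ e q).feat (layerIdx x₀ e q v) i - x₀ i| = _
      rw [h]
      simp [abs_mul, mul_comm]
  | succ l ih =>
    obtain ⟨ψ, hψ, hval⟩ := ih (Nat.le_of_succ_le hl)
    obtain ⟨a, N, hN⟩ := (layeredScheme_compTree K x₀ e).exists_step hl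
    -- The constant is the mean of the values that plus and minus nodes would have without it.
    set c : ℝ := (N.map ψ).sum + (n - (N.card + 4) : ℕ) * ψ (blankTree z l) + 2 * (2 ^ l * |e i|)
      with hc
    refine ⟨fun T => |(∑ j, ψ (augment n (blankTree z l) T.2 j)) - c|, fun S T => ?_,
      fun q hq v hv => ?_⟩
    · refine (abs_abs_sub_abs_le_abs_sub _ _).trans ?_
      rw [sub_sub_sub_cancel_right]
      refine (abs_sum_augment_sub_le_augWasserstein n _ _ _ hψ).trans ?_
      exact le_add_of_nonneg_left (lpDist_nonneg _ _ _)
    · have h1 : (compTree (layeredFeatGraph K x₀ e q) (l + 1) (layerIdx x₀ e q v)).2 =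
          N + ∑ j ∈ childSet (v.pattern q),
            {compTree (layeredFeatGraph K x₀ e q) l (layerIdx x₀ e q (Sum.inl (⟨l, hl⟩, j)))} :=
        (overNbrs_layeredFeatGraph K x₀ e q _ v).trans (hN q hq v hv).2
      have hcard : (N + ∑ j ∈ childSet (v.pattern q),
            {compTree (layeredFeatGraph K x₀ e q) l
              (layerIdx x₀ e q (Sum.inl (⟨l, hl⟩, j)))}).card = N.card + 4 := by
        rw [Multiset.card_add, Multiset.card_sum]
        simp [card_childSet]
      have hle : N.card + 4 ≤ n := by
        rw [← hcard, ← h1]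
        exact (card_overNbrs_le _ _ _).trans hn
      have hsum : ((∑ j ∈ childSet (v.pattern q),
            {compTree (layeredFeatGraph K x₀ e q) l
              (layerIdx x₀ e q (Sum.inl (⟨l, hl⟩, j)))} : Multiset (CompTree d l)).map ψ).sum =
          2 ^ l * |e i| * (2 + 2 * patternSign (v.pattern q)) := by
        rw [← sum_abs_patternSign, Finset.mul_sum, ← Multiset.coe_mapAddMonoidHom,
          map_sum, ← Multiset.coe_sumAddMonoidHom, map_sum]
        refine Finset.sum_congr rfl fun j _ => ?_
        simp only [Multiset.coe_mapAddMonoidHom, Multiset.map_singleton,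
          Multiset.coe_sumAddMonoidHom, Multiset.sum_singleton]
        rw [hval q hq _ rfl]
        rfl
      simp only [h1]
      rw [sum_augment _ (hcard.trans_le hle), hcard, Multiset.map_add, Multiset.sum_add, hsum, hc]
      rw [show ∀ A E s B : ℝ, A + E * (2 + 2 * s) + B - (A + B + 2 * E) = 2 * E * s by
        intros; ring]
      rw [abs_mul, pow_succ, abs_of_nonneg (by positivity)]
      ring

theorem le_TMD_layeredFeatGraph {d : ℕ} {p : ℝ} (hp : 0 < p) {K n : ℕ} (hn : K * 8 + 2 ≤ n)
    (z x₀ e : Vec d) (i : Fin d) :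
    |e i| ≤ TMD p n z K (layeredFeatGraph K x₀ e splitTops)
      (layeredFeatGraph K x₀ e neutralTops) := by
  obtain ⟨ψ, hψ, hval⟩ := exists_lipschitz_compTree hp hn z x₀ e i le_rfl
  refine le_trans ?_ (abs_sum_augment_sub_le_augWasserstein n _ _ _ hψ)
  have hcard : ∀ q, ((layeredFeatGraph K x₀ e q).overNodes
      (compTree (layeredFeatGraph K x₀ e q) K)).card = K * 8 + 2 := by
    intro q
    unfold FeatGraph.overNodes
    rw [Multiset.card_map]
    exact Fintype.card_fin _
  rw [sum_augment _ ((hcard _).trans_le hn), sum_augment _ ((hcard _).trans_le hn), hcard, hcard,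
    add_sub_add_right_eq_sub, overNodes_layeredFeatGraph, overNodes_layeredFeatGraph]
  have h1 : ∀ x, compTree (layeredFeatGraph K x₀ e splitTops) K
      (layerIdx x₀ e splitTops (Sum.inl x)) =
      compTree (layeredFeatGraph K x₀ e neutralTops) K (layerIdx x₀ e neutralTops (Sum.inl x)) :=
    fun x => (layeredScheme_compTree K x₀ e).inl_eq le_rfl admissibleTops_splitTops
      admissibleTops_neutralTops x
  simp only [h1, add_sub_add_left_eq_sub]
  have h2 : ∀ q, AdmissibleTops q → ∀ t, ψ (compTree (layeredFeatGraph K x₀ e q) K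
      (layerIdx x₀ e q (Sum.inr t))) = 2 ^ K * |e i| * |patternSign (q t)| :=
    fun q hq t => hval q hq _ rfl
  simp only [h2 _ admissibleTops_splitTops, h2 _ admissibleTops_neutralTops, Fin.sum_univ_two]
  simp only [splitTops, neutralTops, patternSign]
  simp only [Matrix.cons_val, abs_neg, abs_one, abs_zero, mul_zero, mul_one, add_zero, sub_zero]
  refine le_trans ?_ (le_abs_self _)
  have : (1 : ℝ) ≤ 2 ^ K := one_le_pow₀ one_le_two
  nlinarith [abs_nonneg (e i)]

/-! ### Propagation of second differences through the network -/

/-- The symmetric second difference `σ (t + h) + σ (t - h) - 2 σ t`. -/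
def secDiff (σ : ℝ → ℝ) (t h : ℝ) : ℝ := σ (t + h) + σ (t - h) - 2 * σ t

/-- The argument `a ⬝ x - b` of the activation in `m_σ`. -/
def preAct {d : ℕ} (ab : USphere (Fin d) × ℝ) (x : Vec d) : ℝ :=
  (∑ j, ab.1.1 j * x j) - ab.2

/-- The linear part `a ⬝ x` of the argument of the activation in `m_σ`. -/
def preActLin {d : ℕ} (ab : USphere (Fin d) × ℝ) (x : Vec d) : ℝ :=
  ∑ j, ab.1.1 j * x j

theorem preAct_add_smul {d : ℕ} (ab : USphere (Fin d) × ℝ) (x y : Vec d) (s : ℝ) :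
    preAct ab (x + s • y) = preAct ab x + s * preActLin ab y := by
  simp only [preAct, preActLin, PiLp.add_apply, PiLp.smul_apply, smul_eq_mul, mul_add,
    Finset.sum_add_distrib, Finset.mul_sum]
  rw [add_sub_right_comm]
  congr 1
  exact Finset.sum_congr rfl fun j _ => by ring

/-- The children of a plus node carry the values `t ± h`, those of a minus node only the value `t`;
for a neutral node the sum of `σ` lies halfway between. -/
theorem sum_childSet_eq (σ : ℝ → ℝ) (t h : ℝ) (p : Fin 8) :
    ∑ j ∈ childSet p, σ (t + patternSign j * h) =
      (σ (t + h) + σ (t - h) + 2 * σ t) + patternSign p * secDiff σ t h := by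
  fin_cases p <;> simp [childSet, patternSign, secDiff, ← sub_eq_add_neg] <;> ring

theorem sumAct_add {d : ℕ} (σ : ℝ → ℝ) (S T : Multiset (Vec d)) (ab : USphere (Fin d) × ℝ) :
    sumAct σ (S + T) ab = sumAct σ S ab + sumAct σ T ab := by
  simp [sumAct]

theorem sumAct_sum_singleton {d : ℕ} {ι : Type*} (σ : ℝ → ℝ) (s : Finset ι) (f : ι → Vec d)
    (ab : USphere (Fin d) × ℝ) :
    sumAct σ (∑ j ∈ s, {f j}) ab = ∑ j ∈ s, σ (preAct ab (f j)) := by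
  classical
  induction s using Finset.induction_on with
  | empty => simp [sumAct]
  | insert j s hj ih =>
    rw [Finset.sum_insert hj, Finset.sum_insert hj, sumAct_add, ih]
    simp [sumAct, preAct]

theorem combine_add_smul {d W d' : ℕ} (θ : CombineParams d W d') (x : Vec d) (c c' : Fin W → ℝ)
    (s : ℝ) : combine θ x (fun i => c i + s * c' i) = combine θ x c + s • combine θ 0 c' := by
  ext i
  simp only [combine, PiLp.add_apply, PiLp.smul_apply, smul_eq_mul, PiLp.zero_apply, mul_zero,
    Finset.sum_const_zero, zero_add, mul_add, Finset.sum_add_distrib, Finset.mul_sum, ← add_assoc]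
  congr 1
  exact Finset.sum_congr rfl fun j _ => by ring

section

variable {K : ℕ} {D W : ℕ → ℕ}

theorem layeredScheme_nodeFeat (σ : ℝ → ℝ) (w : MPNNParams K D W) (x₀ e : Vec (D 0)) :
    LayeredScheme K (fun k => Vec (D k))
      fun q k hk v => nodeFeat σ (layeredFeatGraph K x₀ e q) w k hk (layerIdx x₀ e q v) :=
  LayeredScheme.of_featGraph (fun G k hk => nodeFeat σ G w k hk) id (fun _ _ => rfl)
    (fun k hk => ⟨fun x S => combine (w.1 ⟨k, hk⟩).2 x fun i => sumAct σ S ((w.1 ⟨k, hk⟩).1 i),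
      fun _ _ => rfl⟩) x₀ e

/-- A neutral node on level `k`. -/
def neutralNode (K k : ℕ) : LayerNode K :=
  if h : k < K then Sum.inl (⟨k, h⟩, 4) else Sum.inr 0

theorem level_neutralNode {k : ℕ} (hk : k ≤ K) : (neutralNode K k).level = k := by
  unfold neutralNode
  split_ifs with h
  · rfl
  · exact le_antisymm (not_lt.1 h) hk

theorem patternSign_neutralNode (k : ℕ) :
    patternSign ((neutralNode K k).pattern neutralTops) = 0 := by
  unfold neutralNode
  split_ifs with h
  · rfl
  · rfl

/-- The feature of the neutral nodes on level `k` after `k` rounds. -/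
noncomputable def layerCenter (σ : ℝ → ℝ) (x₀ e : Vec (D 0)) (w : MPNNParams K D W) (k : ℕ)
    (hk : k ≤ K) : Vec (D k) :=
  nodeFeat σ (layeredFeatGraph K x₀ e neutralTops) w k hk
    (layerIdx x₀ e neutralTops (neutralNode K k))

/-- The difference of the features of the plus nodes and of the neutral nodes on level `k` after
`k` rounds. -/
noncomputable def layerSpread (σ : ℝ → ℝ) (x₀ e : Vec (D 0)) (w : MPNNParams K D W) :
    (k : ℕ) → k ≤ K → Vec (D k)
  | 0, _ => e
  | k + 1, hk => combine (w.1 ⟨k, hk⟩).2 0 fun i =>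
      secDiff σ (preAct ((w.1 ⟨k, hk⟩).1 i) (layerCenter σ x₀ e w k (Nat.le_of_succ_le hk)))
        (preActLin ((w.1 ⟨k, hk⟩).1 i) (layerSpread σ x₀ e w k (Nat.le_of_succ_le hk)))

/-- After `k` rounds the features on level `k` of all admissible layered graphs lie symmetrically
around the feature of the neutral nodes. -/
theorem nodeFeat_eq_center_add_spread (σ : ℝ → ℝ) (x₀ e : Vec (D 0)) (w : MPNNParams K D W) {k : ℕ}
    (hk : k ≤ K) {q : Fin 2 → Fin 8} (hq : AdmissibleTops q) (v : LayerNode K) (hv : v.level = k) :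
    nodeFeat σ (layeredFeatGraph K x₀ e q) w k hk (layerIdx x₀ e q v) =
      layerCenter σ x₀ e w k hk + patternSign (v.pattern q) • layerSpread σ x₀ e w k hk := by
  induction k generalizing q v with
  | zero =>
    simp only [nodeFeat, layerCenter, layerSpread, feat_layeredFeatGraph, hv, if_true,
      level_neutralNode hk, patternSign_neutralNode, zero_smul, add_zero]
  | succ k ih =>
    have hk' := Nat.le_of_succ_le hk
    obtain ⟨a, N, hN⟩ := (layeredScheme_nodeFeat σ w x₀ e).exists_step hk
    set m := layerCenter σ x₀ e w k hk'
    set δ := layerSpread σ x₀ e w k hk'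
    set ab := (w.1 ⟨k, hk⟩).1
    -- The part of the feature that is common to all nodes on level `k + 1`.
    set M := combine (w.1 ⟨k, hk⟩).2 a fun i => sumAct σ N (ab i) +
      (σ (preAct (ab i) m + preActLin (ab i) δ) + σ (preAct (ab i) m - preActLin (ab i) δ) +
        2 * σ (preAct (ab i) m)) with hM
    have key : ∀ q, AdmissibleTops q → ∀ v : LayerNode K, v.level = k + 1 →
        nodeFeat σ (layeredFeatGraph K x₀ e q) w (k + 1) hk (layerIdx x₀ e q v) =
          M + patternSign (v.pattern q) • layerSpread σ x₀ e w (k + 1) hk := by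
      intro q hq v hv
      obtain ⟨h1, h2⟩ := hN q hq v hv
      rw [← overNbrs_layeredFeatGraph] at h2
      rw [nodeFeat]
      beta_reduce
      rw [h1, h2, layerSpread, hM, ← combine_add_smul]
      congr 1
      funext i
      rw [sumAct_add, sumAct_sum_singleton, add_assoc, ← sum_childSet_eq]
      congr 1
      refine Finset.sum_congr rfl fun j _ => ?_
      rw [ih hk' hq _ rfl, preAct_add_smul]
      rfl
    have hcenter : layerCenter σ x₀ e w (k + 1) hk = M := by
      rw [layerCenter, key _ admissibleTops_neutralTops _ (level_neutralNode hk),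
        patternSign_neutralNode, zero_smul, add_zero]
    rw [key q hq v hv, hcenter]

/-- The outputs of the network on the two graphs differ by a second difference of `σ`. -/
theorem mpnn_sub_mpnn_eq_secDiff (σ : ℝ → ℝ) (x₀ e : Vec (D 0)) (w : MPNNParams K D W)
    (i : Fin (W K)) :
    mpnn σ (layeredFeatGraph K x₀ e splitTops) w i -
      mpnn σ (layeredFeatGraph K x₀ e neutralTops) w i =
      secDiff σ (preAct (w.2 i) (layerCenter σ x₀ e w K le_rfl))
        (preActLin (w.2 i) (layerSpread σ x₀ e w K le_rfl)) := by
  have h0 : ∀ q, mpnn σ (layeredFeatGraph K x₀ e q) w i =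
      (∑ x, σ (preAct (w.2 i) (nodeFeat σ (layeredFeatGraph K x₀ e q) w K le_rfl
        (layerIdx x₀ e q (Sum.inl x))))) +
      ∑ t, σ (preAct (w.2 i) (nodeFeat σ (layeredFeatGraph K x₀ e q) w K le_rfl
        (layerIdx x₀ e q (Sum.inr t)))) := fun q =>
    overNodes_layeredFeatGraph K x₀ e q _ fun x => σ (preAct (w.2 i) x)
  have h1 : ∀ x, nodeFeat σ (layeredFeatGraph K x₀ e splitTops) w K le_rfl
      (layerIdx x₀ e splitTops (Sum.inl x)) =
      nodeFeat σ (layeredFeatGraph K x₀ e neutralTops) w K le_rfl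
        (layerIdx x₀ e neutralTops (Sum.inl x)) := fun x =>
    (layeredScheme_nodeFeat σ w x₀ e).inl_eq le_rfl admissibleTops_splitTops
      admissibleTops_neutralTops x
  rw [h0, h0]
  simp only [h1, add_sub_add_left_eq_sub, Fin.sum_univ_two]
  have h2 := fun t => nodeFeat_eq_center_add_spread σ x₀ e w le_rfl admissibleTops_splitTops
    (Sum.inr t) rfl
  have h3 := fun t => nodeFeat_eq_center_add_spread σ x₀ e w le_rfl admissibleTops_neutralTops
    (Sum.inr t) rfl
  simp only [h2, h3, preAct_add_smul, LayerNode.pattern_inr]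
  simp only [splitTops, neutralTops, patternSign, Matrix.cons_val, zero_mul, one_mul, neg_mul,
    add_zero, ← sub_eq_add_neg, secDiff]
  ring

/-! ### Bounds for the features -/

theorem abs_coord_sphere_le {ι : Type} [Fintype ι] (a : USphere ι) (j : ι) : |a.1 j| ≤ 1 := by
  have h := PiLp.norm_apply_le a.1 j
  have h2 : ‖a.1‖ = 1 := by simp
  rwa [h2] at h

theorem abs_sum_sphere_mul_le {ι κ : Type} [Fintype ι] [Fintype κ] (a : USphere ι) (f : κ → ι)
    (x : κ → ℝ) {R : ℝ} (hx : ∀ j, |x j| ≤ R) :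
    |∑ j, a.1 (f j) * x j| ≤ Fintype.card κ * R := by
  refine (Finset.abs_sum_le_sum_abs _ _).trans ?_
  rw [← nsmul_eq_mul, ← Finset.card_univ, ← Finset.sum_const]
  refine Finset.sum_le_sum fun j _ => ?_
  rw [abs_mul]
  have h1 := abs_coord_sphere_le a (f j)
  calc |a.1 (f j)| * |x j| ≤ 1 * |x j| := by gcongr
    _ ≤ R := by rw [one_mul]; exact hx j

theorem abs_preActLin_le {d : ℕ} (ab : USphere (Fin d) × ℝ) (x : Vec d) {R : ℝ}
    (hx : ∀ j, |x j| ≤ R) : |preActLin ab x| ≤ d * R := by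
  have := abs_sum_sphere_mul_le ab.1 id (fun j => x j) hx
  rwa [Fintype.card_fin] at this

theorem abs_combine_le {d V d' : ℕ} (θ : CombineParams d V d') (x : Vec d) (c : Fin V → ℝ)
    {R S : ℝ} (hx : ∀ j, |x j| ≤ R) (hc : ∀ l, |c l| ≤ S) (i : Fin d') :
    |combine θ x c i| ≤ d * R + V * S := by
  have h1 := abs_sum_sphere_mul_le (θ i) Sum.inl (fun j => x j) hx
  have h2 := abs_sum_sphere_mul_le (θ i) Sum.inr c hc
  rw [Fintype.card_fin] at h1 h2
  exact (abs_add_le _ _).trans (add_le_add h1 h2)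

/-- All biases of the network lie in `[-B, B]`. -/
def BiasBounded (B : ℝ) (w : MPNNParams K D W) : Prop :=
  (∀ k i, |((w.1 k).1 i).2| ≤ B) ∧ ∀ i, |(w.2 i).2| ≤ B

open Classical in
theorem sumAct_overNbrs {d d' : ℕ} (σ : ℝ → ℝ) (G : FeatGraph d) (f : Fin G.numNodes → Vec d')
    (v : Fin G.numNodes) (ab : USphere (Fin d') × ℝ) :
    sumAct σ (G.overNbrs f v) ab =
      ∑ u ∈ Finset.univ.filter fun u => G.graph.Adj v u, σ (preAct ab (f u)) := by
  unfold sumAct FeatGraph.overNbrs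
  rw [Multiset.map_map]
  rfl

theorem abs_preAct_le {d : ℕ} (ab : USphere (Fin d) × ℝ) (x : Vec d) {R B : ℝ}
    (hx : ∀ j, |x j| ≤ R) (hb : |ab.2| ≤ B) : |preAct ab x| ≤ d * R + B :=
  (abs_sub _ _).trans (add_le_add (abs_preActLin_le ab x hx) hb)

/-- The features stay bounded, uniformly in the graph and in the parameters. -/
theorem exists_nodeFeat_bound {σ : ℝ → ℝ} (hσ : Continuous σ) (B r : ℝ) (N k : ℕ) :
    ∃ R : ℝ, ∀ (hk : k ≤ K) (G : FeatGraph (D 0)), G.numNodes ≤ N → (∀ v j, |G.feat v j| ≤ r) →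
      ∀ w : MPNNParams K D W, BiasBounded B w → ∀ v j, |nodeFeat σ G w k hk v j| ≤ R := by
  classical
  induction k with
  | zero => exact ⟨r, fun _ G _ hG w _ v j => hG v j⟩
  | succ k ih =>
    obtain ⟨R, hR⟩ := ih
    obtain ⟨M, hM⟩ := (isCompact_Icc (a := -(D k * R + B))
      (b := D k * R + B)).exists_bound_of_continuousOn hσ.continuousOn
    refine ⟨D k * R + W k * (N * |M|), fun hk G hN hG w hw v j => ?_⟩
    have hR' := hR (Nat.le_of_succ_le hk) G hN hG w hw
    refine abs_combine_le _ _ _ (hR' v) (fun l => ?_) j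
    rw [sumAct_overNbrs]
    refine (Finset.abs_sum_le_sum_abs _ _).trans ((Finset.sum_le_card_nsmul _ _ |M| ?_).trans ?_)
    · intro u _
      refine (hM _ (abs_le.1 ?_)).trans (le_abs_self M)
      exact abs_preAct_le _ _ (hR' u) (hw.1 _ _)
    · rw [nsmul_eq_mul]
      gcongr
      exact (Finset.card_le_univ _).trans ((Fintype.card_fin _).le.trans hN)

end

/-! ### Second differences of the activations -/

@[simp] theorem secDiff_zero_right (σ : ℝ → ℝ) (t : ℝ) : secDiff σ t 0 = 0 := by
  simp [secDiff, two_mul]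

theorem continuous_relu : Continuous relu := continuous_id.max continuous_const

theorem abs_secDiff_relu_le (t h : ℝ) : |secDiff relu t h| ≤ 2 * |h| := by
  have h1 : |relu (t + h) - relu t| ≤ |h| :=
    (abs_max_sub_max_le_abs _ _ _).trans (by rw [add_sub_cancel_left])
  have h2 : |relu (t - h) - relu t| ≤ |h| :=
    (abs_max_sub_max_le_abs _ _ _).trans (by rw [sub_sub_cancel_left, abs_neg])
  have h3 : secDiff relu t h = (relu (t + h) - relu t) + (relu (t - h) - relu t) := by
    rw [secDiff]; ring
  rw [h3]
  exact (abs_add_le _ _).trans (by linarith)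

/-- The second difference of `relu` vanishes unless the kink at `0` is within the step size. -/
theorem abs_le_of_secDiff_relu_ne_zero {t h : ℝ} (hne : secDiff relu t h ≠ 0) : |t| ≤ |h| := by
  contrapose! hne
  have h1 := neg_abs_le h
  have h2 := le_abs_self h
  rcases lt_abs.1 hne with ht | ht
  · rw [secDiff, relu, relu, relu, max_eq_left (by linarith), max_eq_left (by linarith),
      max_eq_left (by linarith)]
    ring
  · rw [secDiff, relu, relu, relu, max_eq_right (by linarith), max_eq_right (by linarith),
      max_eq_right (by linarith)]
    ring

theorem exists_abs_secDiff_le {σ : ℝ → ℝ} (hσ : ContDiff ℝ 2 σ) (T : ℝ) :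
    ∃ M : ℝ, 0 ≤ M ∧ ∀ t h, |t| + |h| ≤ T → |secDiff σ t h| ≤ M * h ^ 2 := by
  have hσ1 : ContDiff ℝ 1 (deriv σ) := by
    have : ContDiff ℝ (1 + 1) σ := by norm_num; exact hσ
    exact (contDiff_succ_iff_deriv.1 this).2.2
  have hd : ∀ x, HasDerivAt σ (deriv σ x) x := fun x =>
    (hσ.differentiable (by norm_num) x).hasDerivAt
  have hd' : ∀ x, HasDerivAt (deriv σ) (deriv (deriv σ) x) x := fun x =>
    (hσ1.differentiable (by norm_num) x).hasDerivAt
  obtain ⟨M, hM⟩ := (isCompact_Icc (a := -T) (b := T)).exists_bound_of_continuousOn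
    (hσ1.continuous_deriv le_rfl).continuousOn
  refine ⟨2 * |M|, by positivity, fun t h hT => ?_⟩
  have hlip : ∀ x ∈ Set.Icc (-T) T, ∀ y ∈ Set.Icc (-T) T,
      |deriv σ y - deriv σ x| ≤ |M| * |y - x| := fun x hx y hy =>
    (convex_Icc (-T) T).norm_image_sub_le_of_norm_hasDerivWithin_le
      (fun u _ => (hd' u).hasDerivWithinAt) (fun u hu => (hM u hu).trans (le_abs_self M)) hx hy
  have hmem : ∀ u ∈ Set.Icc (-|h|) |h|, t + u ∈ Set.Icc (-T) T ∧ t - u ∈ Set.Icc (-T) T := by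
    intro u hu
    have h1 := neg_abs_le t
    have h2 := le_abs_self t
    have h3 := hu.1
    have h4 := hu.2
    exact ⟨⟨by linarith, by linarith⟩, ⟨by linarith, by linarith⟩⟩
  have hder : ∀ u, HasDerivAt (fun u => σ (t + u) + σ (t - u))
      (deriv σ (t + u) - deriv σ (t - u)) u := fun u =>
    ((hd (t + u)).comp_const_add t u).add ((hd (t - u)).comp_const_sub t u)
  have hbound : ∀ u ∈ Set.Icc (-|h|) |h|,
      ‖deriv σ (t + u) - deriv σ (t - u)‖ ≤ 2 * |M| * |h| := by
    intro u hu
    refine (hlip _ (hmem u hu).2 _ (hmem u hu).1).trans ?_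
    have h1 : |t + u - (t - u)| ≤ 2 * |h| := by
      rw [show t + u - (t - u) = 2 * u by ring, abs_mul, abs_two]
      have := abs_le.2 hu
      linarith
    calc |M| * |t + u - (t - u)| ≤ |M| * (2 * |h|) := by gcongr
      _ = 2 * |M| * |h| := by ring
  have hfin := (convex_Icc (-|h|) |h|).norm_image_sub_le_of_norm_hasDerivWithin_le
    (fun u _ => (hder u).hasDerivWithinAt) hbound
    (x := 0) ⟨neg_nonpos.2 (abs_nonneg h), abs_nonneg h⟩ (y := h) ⟨neg_abs_le h, le_abs_self h⟩
  have heq : secDiff σ t h = (σ (t + h) + σ (t - h)) - (σ (t + 0) + σ (t - 0)) := by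
    rw [secDiff, add_zero, sub_zero]; ring
  rw [heq]
  refine hfin.trans (le_of_eq ?_)
  rw [sub_zero, Real.norm_eq_abs, ← sq_abs h]
  ring

/-! ### Bounds for the spread -/

section

variable {K : ℕ} {D W : ℕ → ℕ}

theorem exists_layerSpread_relu_bound (k : ℕ) :
    ∃ C : ℝ, 0 ≤ C ∧ ∀ (hk : k ≤ K) (x₀ e : Vec (D 0)) (r : ℝ), (∀ j, |e j| ≤ r) →
      ∀ (w : MPNNParams K D W) j, |layerSpread relu x₀ e w k hk j| ≤ C * r := by
  induction k with
  | zero => exact ⟨1, zero_le_one, fun _ _ _ r he _ j => by rw [one_mul]; exact he j⟩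
  | succ k ih =>
    obtain ⟨C, hC0, hC⟩ := ih
    refine ⟨W k * (2 * (D k * C)), by positivity, fun hk x₀ e r he w j => ?_⟩
    refine (abs_combine_le _ 0 _ (R := 0) (S := 2 * (D k * (C * r))) (by simp) (fun l => ?_)
      j).trans (le_of_eq (by ring))
    refine (abs_secDiff_relu_le _ _).trans ?_
    gcongr
    exact abs_preActLin_le _ _ (hC _ x₀ e r he w)

theorem exists_preActLin_layerSpread_relu_bound :
    ∃ C : ℝ, 0 ≤ C ∧ ∀ (k : ℕ) (hk : k ≤ K) (x₀ e : Vec (D 0)) (r : ℝ), 0 ≤ r → (∀ j, |e j| ≤ r) →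
      ∀ (w : MPNNParams K D W) ab, |preActLin ab (layerSpread relu x₀ e w k hk)| ≤ C * r := by
  choose C hC0 hC using exists_layerSpread_relu_bound (K := K) (D := D) (W := W)
  refine ⟨∑ k ∈ Finset.range (K + 1), D k * C k,
    Finset.sum_nonneg fun k _ => mul_nonneg (Nat.cast_nonneg _) (hC0 k),
    fun k hk x₀ e r hr he w ab => ?_⟩
  refine (abs_preActLin_le ab _ (hC k hk x₀ e r he w)).trans ?_
  rw [← mul_assoc]
  gcongr
  exact Finset.single_le_sum (f := fun k => (D k : ℝ) * C k)
    (fun k _ => mul_nonneg (Nat.cast_nonneg _) (hC0 k)) (Finset.mem_range.2 (by omega))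

/-- The spread can survive layer `k + 1` only if some bias of this layer puts the kink of the
activation close to the features of the neutral nodes on level `k`. -/
theorem exists_preAct_le_of_layerSpread_ne_zero {x₀ e : Vec (D 0)} {w : MPNNParams K D W} {ρ : ℝ}
    (hρ : ∀ (k : ℕ) (hk : k ≤ K) ab, |preActLin ab (layerSpread relu x₀ e w k hk)| ≤ ρ) {k : ℕ}
    (hk : k ≤ K) (hne : layerSpread relu x₀ e w k hk ≠ 0) (j : ℕ) (hj : j < k) :
    ∃ i, |preAct ((w.1 ⟨j, hj.trans_le hk⟩).1 i)
      (layerCenter relu x₀ e w j (hj.le.trans hk))| ≤ ρ := by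
  induction k with
  | zero => omega
  | succ k ih =>
    obtain ⟨i, hi⟩ : ∃ i, secDiff relu (preAct ((w.1 ⟨k, hk⟩).1 i)
        (layerCenter relu x₀ e w k (Nat.le_of_succ_le hk)))
        (preActLin ((w.1 ⟨k, hk⟩).1 i) (layerSpread relu x₀ e w k (Nat.le_of_succ_le hk))) ≠ 0 := by
      by_contra! hall
      refine hne ?_
      rw [layerSpread]
      simp only [hall]
      ext i
      simp [combine]
    rcases Nat.lt_succ_iff_lt_or_eq.1 hj with hjk | rfl
    · refine ih (Nat.le_of_succ_le hk) (fun h0 => hi ?_) hjk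
      rw [h0]
      simp [preActLin]
    · exact ⟨i, (abs_le_of_secDiff_relu_ne_zero hi).trans (hρ _ _ _)⟩

theorem exists_feat_layeredFeatGraph_eq {d : ℕ} (x₀ e : Vec d) (q : Fin 2 → Fin 8)
    (v : Fin (layeredFeatGraph K x₀ e q).numNodes) :
    ∃ s : ℝ, |s| ≤ 1 ∧ (layeredFeatGraph K x₀ e q).feat v = x₀ + s • e := by
  refine ⟨_, ?_, rfl⟩
  have hs : ∀ p, |patternSign p| ≤ 1 := by
    intro p
    fin_cases p <;> simp [patternSign]
  split_ifs
  · exact hs _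
  · simp

theorem abs_feat_layeredFeatGraph_le {d : ℕ} (x₀ e : Vec d) (q : Fin 2 → Fin 8) {r₀ r : ℝ}
    (hx : ∀ j, |x₀ j| ≤ r₀) (he : ∀ j, |e j| ≤ r)
    (v : Fin (layeredFeatGraph K x₀ e q).numNodes) (j : Fin d) :
    |(layeredFeatGraph K x₀ e q).feat v j| ≤ r₀ + r := by
  obtain ⟨s, hs, h⟩ := exists_feat_layeredFeatGraph_eq x₀ e q v
  rw [h]
  refine (abs_add_le _ _).trans (add_le_add (hx j) ?_)
  have h1 : |s * e j| ≤ r := by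
    rw [abs_mul]
    exact (mul_le_of_le_one_left (abs_nonneg _) hs).trans (he j)
  exact h1

/-- For a smooth activation each layer squares the size of the spread. -/
theorem exists_secDiff_layerSpread_bound {σ : ℝ → ℝ} (hσ : ContDiff ℝ 2 σ) (B r₀ r : ℝ)
    (hr : 0 ≤ r) (k : ℕ) (C : ℝ) (hC0 : 0 ≤ C) :
    ∃ M : ℝ, 0 ≤ M ∧ ∀ (hk : k ≤ K) (x₀ e : Vec (D 0)) (ε : ℝ), 0 ≤ ε → ε ≤ 1 →
      (∀ j, |x₀ j| ≤ r₀) → (∀ j, |e j| ≤ r * ε) → ∀ w : MPNNParams K D W, BiasBounded B w →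
      (∀ j, |layerSpread σ x₀ e w k hk j| ≤ C * ε ^ 2 ^ k) →
      ∀ ab : USphere (Fin (D k)) × ℝ, |ab.2| ≤ B →
      |secDiff σ (preAct ab (layerCenter σ x₀ e w k hk))
        (preActLin ab (layerSpread σ x₀ e w k hk))| ≤ M * ε ^ 2 ^ (k + 1) := by
  obtain ⟨R, hR⟩ := exists_nodeFeat_bound (K := K) (D := D) (W := W) hσ.continuous B (r₀ + r)
    (K * 8 + 2) k
  obtain ⟨M, hM0, hM⟩ := exists_abs_secDiff_le hσ (D k * R + B + D k * C)
  refine ⟨M * (D k * C) ^ 2, by positivity, fun hk x₀ e ε hε0 hε1 hx he w hw hs ab hb => ?_⟩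
  have h1 : |preActLin ab (layerSpread σ x₀ e w k hk)| ≤ D k * (C * ε ^ 2 ^ k) :=
    abs_preActLin_le ab _ hs
  have h2 : |preAct ab (layerCenter σ x₀ e w k hk)| ≤ D k * R + B := by
    refine abs_preAct_le ab _ (hR hk _ le_rfl (fun v j => ?_) w hw _) hb
    refine abs_feat_layeredFeatGraph_le x₀ e _ hx (fun j => (he j).trans ?_) v j
    exact mul_le_of_le_one_right hr hε1
  have h3 : ε ^ 2 ^ k ≤ 1 := pow_le_one₀ hε0 hε1
  refine (hM _ _ ?_).trans ?_
  · refine add_le_add h2 (h1.trans ?_)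
    gcongr
    exact mul_le_of_le_one_right hC0 h3
  · rw [← sq_abs]
    calc M * |preActLin ab (layerSpread σ x₀ e w k hk)| ^ 2
        ≤ M * (D k * (C * ε ^ 2 ^ k)) ^ 2 := by gcongr
      _ = M * (D k * C) ^ 2 * ε ^ 2 ^ (k + 1) := by
        rw [pow_succ 2 k, pow_mul ε]; ring

theorem exists_layerSpread_bound {σ : ℝ → ℝ} (hσ : ContDiff ℝ 2 σ) (B r₀ r : ℝ)
    (hr : 0 ≤ r) (k : ℕ) :
    ∃ C : ℝ, 0 ≤ C ∧ ∀ (hk : k ≤ K) (x₀ e : Vec (D 0)) (ε : ℝ), 0 ≤ ε → ε ≤ 1 →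
      (∀ j, |x₀ j| ≤ r₀) → (∀ j, |e j| ≤ r * ε) → ∀ w : MPNNParams K D W, BiasBounded B w →
      ∀ j, |layerSpread σ x₀ e w k hk j| ≤ C * ε ^ 2 ^ k := by
  induction k with
  | zero => exact ⟨r, hr, fun _ x₀ e ε _ _ _ he w _ j => by simpa [layerSpread] using he j⟩
  | succ k ih =>
    obtain ⟨C, hC0, hC⟩ := ih
    obtain ⟨M, hM0, hM⟩ := exists_secDiff_layerSpread_bound (K := K) (D := D) (W := W) hσ B r₀ r hr
      k C hC0
    refine ⟨W k * M, by positivity, fun hk x₀ e ε hε0 hε1 hx he w hw j => ?_⟩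
    refine (abs_combine_le _ 0 _ (R := 0) (S := M * ε ^ 2 ^ (k + 1)) (by simp) (fun l => ?_)
      j).trans (le_of_eq (by ring))
    exact hM _ x₀ e ε hε0 hε1 hx he w hw (hC _ x₀ e ε hε0 hε1 hx he w hw) _ (hw.1 _ _)

end

/-! ### Dependence of the features on the parameters -/

section

variable {K : ℕ} {D W : ℕ → ℕ}

theorem nodeFeat_congr (σ : ℝ → ℝ) (G : FeatGraph (D 0)) {w w' : MPNNParams K D W} {k : ℕ}
    (hk : k ≤ K) (h : ∀ i : Fin K, (i : ℕ) < k → w.1 i = w'.1 i) :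
    nodeFeat σ G w k hk = nodeFeat σ G w' k hk := by
  induction k with
  | zero => rfl
  | succ k ih =>
    have h1 := ih (Nat.le_of_succ_le hk) fun i hi => h i (by omega)
    funext v
    simp only [nodeFeat, h1, h ⟨k, hk⟩ (Nat.lt_succ_self k)]

theorem continuous_preAct {X : Type*} [TopologicalSpace X] {d : ℕ}
    {f : X → USphere (Fin d) × ℝ} {g : X → Vec d} (hf : Continuous f) (hg : Continuous g) :
    Continuous fun x => preAct (f x) (g x) := by
  unfold preAct
  fun_prop

theorem continuous_nodeFeat {σ : ℝ → ℝ} (hσ : Continuous σ) (G : FeatGraph (D 0)) {k : ℕ}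
    (hk : k ≤ K) (v : Fin G.numNodes) :
    Continuous fun w : MPNNParams K D W => nodeFeat σ G w k hk v := by
  classical
  induction k generalizing v with
  | zero => exact continuous_const
  | succ k ih =>
    have h1 := ih (Nat.le_of_succ_le hk)
    have h2 : ∀ i, Continuous fun w : MPNNParams K D W => sumAct σ
        (G.overNbrs (nodeFeat σ G w k (Nat.le_of_succ_le hk)) v) ((w.1 ⟨k, hk⟩).1 i) := by
      intro i
      simp only [sumAct_overNbrs]
      refine continuous_finsetSum _ fun u _ => hσ.comp (continuous_preAct ?_ (h1 u))
      fun_prop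
    simp only [nodeFeat, combine]
    have h1v := h1 v
    fun_prop

end

/-! ### The distribution of the parameters -/

theorem isProbabilityMeasure_unifSphere (ι : Type) [Fintype ι] [Nonempty ι] :
    IsProbabilityMeasure (unifSphere ι) := by
  have : NeZero (volume : Measure (EuclideanSpace ℝ ι)).toSphere := ⟨by
    rw [Ne, Measure.toSphere_eq_zero_iff_finrank, finrank_euclideanSpace]
    exact Fintype.card_ne_zero⟩
  unfold unifSphere
  infer_instance

theorem isProbabilityMeasure_unifInterval {B : ℝ} (hB : 0 < B) :
    IsProbabilityMeasure (unifInterval B) := by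
  constructor
  rw [unifInterval, Measure.smul_apply, Measure.restrict_apply_univ, smul_eq_mul,
    ENNReal.inv_mul_cancel]
  · rw [Real.volume_Icc, Ne, ENNReal.ofReal_eq_zero]
    linarith
  · simp

theorem isProbabilityMeasure_sumParamsMeasure {d : ℕ} (hd : 1 ≤ d) (V : ℕ) {B : ℝ} (hB : 0 < B) :
    IsProbabilityMeasure (sumParamsMeasure d V B) := by
  have : Nonempty (Fin d) := ⟨⟨0, hd⟩⟩
  have := isProbabilityMeasure_unifSphere (Fin d)
  have := isProbabilityMeasure_unifInterval hB
  unfold sumParamsMeasure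
  infer_instance

theorem isProbabilityMeasure_combineParamsMeasure {d : ℕ} (hd : 1 ≤ d) (V d' : ℕ) :
    IsProbabilityMeasure (combineParamsMeasure d V d') := by
  have : Nonempty (Fin d) := ⟨⟨0, hd⟩⟩
  have := isProbabilityMeasure_unifSphere (Fin d ⊕ Fin V)
  unfold combineParamsMeasure
  infer_instance

theorem ae_abs_le_unifInterval (B : ℝ) : ∀ᵐ b ∂unifInterval B, |b| ≤ B := by
  refine Measure.ae_smul_measure ?_ _
  filter_upwards [ae_restrict_mem measurableSet_Icc] with b hb
  exact abs_le.2 hb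

/-- A uniformly distributed bias hits an interval of length `2 ρ` with probability at most
`ρ / B`. -/
theorem unifInterval_abs_sub_le {B : ℝ} (hB : 0 < B) (t ρ : ℝ) :
    unifInterval B {b | |t - b| ≤ ρ} ≤ ENNReal.ofReal (ρ / B) := by
  have h1 : {b : ℝ | |t - b| ≤ ρ} = Set.Icc (t - ρ) (t + ρ) := by
    ext b
    rw [Set.mem_ofPred_eq, Set.mem_Icc, abs_le]
    constructor <;> rintro ⟨h, h'⟩ <;> constructor <;> linarith
  rw [h1, unifInterval, Measure.smul_apply, smul_eq_mul]
  calc (volume (Set.Icc (-B) B))⁻¹ * volume.restrict (Set.Icc (-B) B) (Set.Icc (t - ρ) (t + ρ))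
      ≤ (volume (Set.Icc (-B) B))⁻¹ * volume (Set.Icc (t - ρ) (t + ρ)) := by
        gcongr
        exact Measure.restrict_le_self
    _ = ENNReal.ofReal (ρ / B) := by
        rw [Real.volume_Icc, Real.volume_Icc, mul_comm, ← div_eq_mul_inv,
          ← ENNReal.ofReal_div_of_pos (by linarith)]
        congr 1
        field_simp
        ring

/-- The probability that one of the kinks of `V` random neurons is close to a given feature. -/
theorem sumParamsMeasure_exists_abs_preAct_le {d : ℕ} (hd : 1 ≤ d) (V : ℕ) {B : ℝ} (hB : 0 < B)
    (x : Vec d) (ρ : ℝ) :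
    sumParamsMeasure d V B {ab | ∃ i, |preAct (ab i) x| ≤ ρ} ≤ V * ENNReal.ofReal (ρ / B) := by
  have : Nonempty (Fin d) := ⟨⟨0, hd⟩⟩
  have := isProbabilityMeasure_unifSphere (Fin d)
  have := isProbabilityMeasure_unifInterval hB
  have hmeas : MeasurableSet {ab : USphere (Fin d) × ℝ | |preAct ab x| ≤ ρ} :=
    measurableSet_le (continuous_preAct continuous_id continuous_const).abs.measurable
      measurable_const
  have h1 : (unifSphere (Fin d)).prod (unifInterval B) {ab | |preAct ab x| ≤ ρ} ≤
      ENNReal.ofReal (ρ / B) := by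
    rw [Measure.prod_apply hmeas]
    calc ∫⁻ a, unifInterval B (Prod.mk a ⁻¹' {ab | |preAct ab x| ≤ ρ}) ∂unifSphere (Fin d)
        ≤ ∫⁻ _, ENNReal.ofReal (ρ / B) ∂unifSphere (Fin d) :=
          lintegral_mono fun a => unifInterval_abs_sub_le hB (∑ j, a.1 j * x j) ρ
      _ = ENNReal.ofReal (ρ / B) := by simp
  have h2 : {ab : SumParams d V | ∃ i, |preAct (ab i) x| ≤ ρ} =
      ⋃ i, Function.eval i ⁻¹' {ab | |preAct ab x| ≤ ρ} := by
    ext ab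
    simp
  rw [h2]
  refine (measure_iUnion_fintype_le _ _).trans ?_
  have h3 : ∀ i : Fin V, sumParamsMeasure d V B (Function.eval i ⁻¹' {ab | |preAct ab x| ≤ ρ}) ≤
      ENNReal.ofReal (ρ / B) := by
    intro i
    rw [sumParamsMeasure, (measurePreserving_eval _ i).measure_preimage hmeas.nullMeasurableSet]
    exact h1
  refine (Finset.sum_le_sum fun i _ => h3 i).trans ?_
  simp

theorem ae_sumParamsMeasure_abs_le {d : ℕ} (hd : 1 ≤ d) (V : ℕ) {B : ℝ} (hB : 0 < B) :
    ∀ᵐ ab ∂sumParamsMeasure d V B, ∀ i, |(ab i).2| ≤ B := by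
  have : Nonempty (Fin d) := ⟨⟨0, hd⟩⟩
  have := isProbabilityMeasure_unifSphere (Fin d)
  have := isProbabilityMeasure_unifInterval hB
  have h1 : ∀ᵐ ab ∂(unifSphere (Fin d)).prod (unifInterval B), |ab.2| ≤ B :=
    Measure.quasiMeasurePreserving_snd.ae (ae_abs_le_unifInterval B)
  exact ae_all_iff.2 fun i => (Measure.tendsto_eval_ae_ae
    (μ := fun _ : Fin V => (unifSphere (Fin d)).prod (unifInterval B)) (i := i)).eventually h1

theorem ae_biasBounded {K : ℕ} {D : ℕ → ℕ} (W : ℕ → ℕ) (hD : ∀ k, 1 ≤ D k) {B : ℝ} (hB : 0 < B) :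
    ∀ᵐ w ∂mpnnMeasure K D W B, BiasBounded B w := by
  have := fun k => isProbabilityMeasure_sumParamsMeasure (hD k) (W k) hB
  have := fun k => isProbabilityMeasure_combineParamsMeasure (hD k) (W k) (D (k + 1))
  have h1 := fun k => ae_sumParamsMeasure_abs_le (hD k) (W k) hB
  have h2 : ∀ k : Fin K, ∀ᵐ θ ∂(sumParamsMeasure (D k) (W k) B).prod
      (combineParamsMeasure (D k) (W k) (D (k + 1))), ∀ i, |(θ.1 i).2| ≤ B := fun k =>
    Measure.quasiMeasurePreserving_fst.ae (h1 k)
  have hpr : ∀ k : Fin K, SigmaFinite ((sumParamsMeasure (D k) (W k) B).prod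
      (combineParamsMeasure (D k) (W k) (D (k + 1)))) := fun k => inferInstance
  have h3 : ∀ᵐ w₁ ∂(Measure.pi fun k : Fin K => (sumParamsMeasure (D k) (W k) B).prod
      (combineParamsMeasure (D k) (W k) (D (k + 1)))), ∀ k i, |((w₁ k).1 i).2| ≤ B :=
    ae_all_iff.2 fun k => (Measure.tendsto_eval_ae_ae
      (μ := fun k : Fin K => (sumParamsMeasure (D k) (W k) B).prod
        (combineParamsMeasure (D k) (W k) (D (k + 1)))) (i := k)).eventually (h2 k)
  exact (Measure.quasiMeasurePreserving_fst.ae h3).and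
    (Measure.quasiMeasurePreserving_snd.ae (h1 K))

/-- Successive conditioning: if the event `E k` is determined by the coordinates up to `k` and has
conditional probability at most `q` given the coordinates before `k`, then all `K` events occur
together with probability at most `q ^ K`. -/
theorem pi_iInter_le_pow {K : ℕ} {X : Fin K → Type*} [∀ i, MeasurableSpace (X i)]
    (μ : ∀ i, Measure (X i)) [∀ i, IsProbabilityMeasure (μ i)] {E : Fin K → Set (∀ i, X i)}
    (hE : ∀ k, MeasurableSet (E k))
    (hdep : ∀ k w w', (∀ i ≤ k, w i = w' i) → w ∈ E k → w' ∈ E k) {q : ENNReal}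
    (hq : ∀ k w, μ k {x | Function.update w k x ∈ E k} ≤ q) :
    Measure.pi μ (⋂ k, E k) ≤ q ^ K := by
  classical
  set f : (∀ i, X i) → ENNReal := (⋂ k, E k).indicator 1 with hf
  have hfm : Measurable f := measurable_one.indicator (MeasurableSet.iInter hE)
  -- Integrate over the last `m` coordinates.
  have key : ∀ m, m ≤ K → ∀ x, lmarginal μ (Finset.univ.filter fun i : Fin K => K ≤ i + m) f x ≤
      q ^ m * {x | ∀ k : Fin K, k + m < K → x ∈ E k}.indicator 1 x := by
    intro m
    induction m with
    | zero =>
      intro _ x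
      have h1 : (Finset.univ.filter fun i : Fin K => K ≤ i + 0) = ∅ := by
        ext i
        simp
      have h2 : {x | ∀ k : Fin K, k + 0 < K → x ∈ E k} = ⋂ k, E k := by
        ext x
        simp
      rw [h1, h2, lmarginal_empty, pow_zero, one_mul]
    | succ m ih =>
      intro hm x
      set k : Fin K := ⟨K - (m + 1), by omega⟩ with hk
      have h1 : (Finset.univ.filter fun i : Fin K => K ≤ i + (m + 1)) =
          insert k (Finset.univ.filter fun i : Fin K => K ≤ i + m) := by
        ext i
        simp only [Finset.mem_filter_univ, Finset.mem_insert, hk, Fin.ext_iff]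
        omega
      have hkm : (k : ℕ) + m < K := by simp only [hk]; omega
      rw [h1, lmarginal_insert _ hfm (by rw [Finset.mem_filter_univ]; omega)]
      refine (lintegral_mono fun y => ih (by omega) (Function.update x k y)).trans ?_
      by_cases hx : ∀ j : Fin K, j + (m + 1) < K → x ∈ E j
      · have hS : MeasurableSet {y | Function.update x k y ∈ E k} :=
          measurable_update x (hE k)
        rw [Set.indicator_of_mem (s := {x | ∀ k : Fin K, k + (m + 1) < K → x ∈ E k}) hx]
        calc ∫⁻ y, q ^ m * {x | ∀ k : Fin K, k + m < K → x ∈ E k}.indicator 1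
              (Function.update x k y) ∂μ k
            ≤ ∫⁻ y, q ^ m * {y | Function.update x k y ∈ E k}.indicator 1 y ∂μ k := by
              refine lintegral_mono fun y => ?_
              gcongr
              by_cases hy : Function.update x k y ∈ E k
              · rw [Set.indicator_of_mem (s := {y | Function.update x k y ∈ E k}) hy]
                exact Set.indicator_le_self _ _ _
              · rw [Set.indicator_of_notMem (s := {x | ∀ k : Fin K, k + m < K → x ∈ E k})
                  fun h => hy (h k hkm)]
                exact zero_le
          _ = q ^ m * μ k {y | Function.update x k y ∈ E k} := by
              rw [lintegral_const_mul _ (measurable_one.indicator hS), lintegral_indicator_one hS]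
          _ ≤ q ^ (m + 1) * (1 : (∀ i, X i) → ENNReal) x := by
              rw [pow_succ, Pi.one_apply, mul_one]
              gcongr
              exact hq k x
      · rw [Set.indicator_of_notMem (s := {x | ∀ k : Fin K, k + (m + 1) < K → x ∈ E k}) hx,
          mul_zero]
        push Not at hx
        obtain ⟨j, hj, hxj⟩ := hx
        refine le_of_eq ((lintegral_congr fun y => ?_).trans lintegral_zero)
        rw [Set.indicator_of_notMem, mul_zero]
        intro h
        refine hxj (hdep j _ _ (fun i hi => ?_) (h j (by omega)))
        rw [Function.update_of_ne]
        rintro rfl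
        rw [Fin.le_def] at hi
        simp only [hk] at hi
        omega
  have hne : ∀ i, Nonempty (X i) := fun i => (μ i).nonempty_of_neZero
  let x : ∀ i, X i := fun i => (hne i).some
  have hK : (Finset.univ.filter fun i : Fin K => K ≤ i + K) = Finset.univ := by
    ext i
    simp
  have := key K le_rfl x
  rw [hK, ← lintegral_eq_lmarginal_univ, hf,
    lintegral_indicator_one (MeasurableSet.iInter hE)] at this
  refine this.trans ?_
  calc _ ≤ q ^ K * (1 : (∀ i, X i) → ENNReal) x := by
        gcongr
        exact Set.indicator_le_self _ _ _
    _ = q ^ K := by rw [Pi.one_apply, mul_one]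

theorem opensMeasurableSpace_mpnnParams (K : ℕ) (D W : ℕ → ℕ) :
    OpensMeasurableSpace (MPNNParams K D W) := by
  have h1 : OpensMeasurableSpace (∀ k : Fin K, SumParams (D k) (W k) ×
      CombineParams (D k) (W k) (D (k + 1))) := inferInstance
  have h2 : OpensMeasurableSpace (SumParams (D K) (W K)) := inferInstance
  have h3 : SecondCountableTopology (SumParams (D K) (W K)) := inferInstance
  have h4 : SecondCountableTopologyEither (∀ k : Fin K, SumParams (D k) (W k) ×
      CombineParams (D k) (W k) (D (k + 1))) (SumParams (D K) (W K)) :=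
    secondCountableTopologyEither_of_right _ _
  exact Prod.opensMeasurableSpace

/-- The probability that in each of the `K + 1` layers some kink is close to the features of the
neutral nodes. -/
theorem mpnnMeasure_kinks_le {K : ℕ} {D : ℕ → ℕ} (W : ℕ → ℕ) (hD : ∀ k, 1 ≤ D k) {B : ℝ}
    (hB : 0 < B) (x₀ e : Vec (D 0)) (ρ : ℝ) :
    mpnnMeasure K D W B {w | (∀ k : Fin K, ∃ i, |preAct ((w.1 k).1 i)
      (layerCenter relu x₀ e w k k.2.le)| ≤ ρ) ∧
      ∃ i, |preAct (w.2 i) (layerCenter relu x₀ e w K le_rfl)| ≤ ρ} ≤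
      ((∑ k ∈ Finset.range (K + 1), W k : ℕ) * ENNReal.ofReal (ρ / B)) ^ (K + 1) := by
  have := fun k => isProbabilityMeasure_sumParamsMeasure (hD k) (W k) hB
  have := fun k => isProbabilityMeasure_combineParamsMeasure (hD k) (W k) (D (k + 1))
  have := opensMeasurableSpace_mpnnParams K D W
  set q : ENNReal := (∑ k ∈ Finset.range (K + 1), W k : ℕ) * ENNReal.ofReal (ρ / B) with hq
  have hWq : ∀ k ≤ K, (W k : ENNReal) * ENNReal.ofReal (ρ / B) ≤ q := by
    intro k hk
    rw [hq]
    gcongr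
    exact Finset.single_le_sum (f := W) (fun _ _ => Nat.zero_le _)
      (Finset.mem_range.2 (Nat.lt_succ_of_le hk))
  have hcont : ∀ k (hk : k ≤ K), Continuous fun w : MPNNParams K D W =>
      layerCenter relu x₀ e w k hk := fun k hk => continuous_nodeFeat continuous_relu _ hk _
  have hcongr : ∀ k (hk : k ≤ K) (w w' : MPNNParams K D W),
      (∀ i : Fin K, (i : ℕ) < k → w.1 i = w'.1 i) →
      layerCenter relu x₀ e w k hk = layerCenter relu x₀ e w' k hk := fun k hk w w' h =>
    congrFun (nodeFeat_congr _ _ hk h) _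
  obtain ⟨w₂⟩ := (sumParamsMeasure (D K) (W K) B).nonempty_of_neZero
  set E : ∀ k : Fin K, Set (∀ k : Fin K, SumParams (D k) (W k) ×
      CombineParams (D k) (W k) (D (k + 1))) := fun k => {w₁ | ∃ i, |preAct ((w₁ k).1 i)
      (layerCenter relu x₀ e (w₁, w₂) k k.2.le)| ≤ ρ} with hEdef
  have hEm : ∀ k, MeasurableSet (E k) := by
    intro k
    simp only [hEdef, Set.ofPred_exists]
    refine MeasurableSet.iUnion fun i => measurableSet_le ?_ measurable_const
    refine (continuous_preAct ?_ ?_).abs.measurable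
    · fun_prop
    · exact (hcont k k.2.le).comp (continuous_id.prodMk continuous_const)
  have hE : Measure.pi (fun k : Fin K => (sumParamsMeasure (D k) (W k) B).prod
      (combineParamsMeasure (D k) (W k) (D (k + 1)))) (⋂ k, E k) ≤ q ^ K := by
    refine pi_iInter_le_pow _ hEm (fun k w w' h hw => ?_) fun k w => ?_
    · obtain ⟨i, hi⟩ := hw
      refine ⟨i, ?_⟩
      rw [← h k le_rfl, ← hcongr k k.2.le (w, w₂) (w', w₂) fun i hi => h i (Fin.le_def.2 hi.le)]
      exact hi
    · set m := layerCenter relu x₀ e (w, w₂) k k.2.le with hm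
      have h1 : {x | Function.update w k x ∈ E k} =
          {ab | ∃ i, |preAct (ab i) m| ≤ ρ} ×ˢ Set.univ := by
        ext x
        have h2 : layerCenter relu x₀ e (Function.update w k x, w₂) k k.2.le = m :=
          hcongr k k.2.le _ _ fun i hi => Function.update_of_ne (Fin.ne_of_lt hi) _ _
        simp only [hEdef, Set.mem_ofPred_eq, h2, Function.update_self, Set.mem_prod, Set.mem_univ,
          and_true]
      rw [h1, Measure.prod_prod, measure_univ, mul_one]
      exact (sumParamsMeasure_exists_abs_preAct_le (hD k) _ hB m ρ).trans (hWq k k.2.le)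
  set S : Set (MPNNParams K D W) := {w | (∀ k : Fin K, ∃ i, |preAct ((w.1 k).1 i)
      (layerCenter relu x₀ e w k k.2.le)| ≤ ρ) ∧
      ∃ i, |preAct (w.2 i) (layerCenter relu x₀ e w K le_rfl)| ≤ ρ} with hS
  have hSm : MeasurableSet S := by
    simp only [hS, Set.ofPred_and, Set.ofPred_forall, Set.ofPred_exists]
    refine MeasurableSet.inter (MeasurableSet.iInter fun k => MeasurableSet.iUnion fun i =>
      measurableSet_le ?_ measurable_const) (MeasurableSet.iUnion fun i =>
      measurableSet_le ?_ measurable_const)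
    · exact (continuous_preAct (by fun_prop) (hcont k k.2.le)).abs.measurable
    · exact (continuous_preAct (by fun_prop) (hcont K le_rfl)).abs.measurable
  rw [mpnnMeasure, Measure.prod_apply hSm]
  calc _ ≤ ∫⁻ w₁, (⋂ k, E k).indicator (fun _ => q) w₁ ∂(Measure.pi fun k : Fin K =>
        (sumParamsMeasure (D k) (W k) B).prod (combineParamsMeasure (D k) (W k) (D (k + 1)))) := by
        refine lintegral_mono fun w₁ => ?_
        by_cases hw : w₁ ∈ ⋂ k, E k
        · rw [Set.indicator_of_mem hw]
          refine le_trans (measure_mono fun x hx => ?_) ((sumParamsMeasure_exists_abs_preAct_le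
            (hD K) _ hB (layerCenter relu x₀ e (w₁, w₂) K le_rfl) ρ).trans (hWq K le_rfl))
          obtain ⟨i, hi⟩ := hx.2
          refine ⟨i, ?_⟩
          rw [hcongr K le_rfl (w₁, w₂) (w₁, x) fun _ _ => rfl]
          exact hi
        · rw [Set.indicator_of_notMem hw, nonpos_iff_eq_zero]
          refine measure_mono_null (fun x hx => hw (Set.mem_iInter.2 fun k => ?_)) measure_empty
          obtain ⟨i, hi⟩ := hx.1 k
          refine ⟨i, ?_⟩
          rw [hcongr k k.2.le (w₁, w₂) (w₁, x) fun _ _ => rfl]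
          exact hi
    _ ≤ q * q ^ K := by
        refine (lintegral_indicator_const_le _ _).trans ?_
        gcongr
    _ = q ^ (K + 1) := (pow_succ' q K).symm

/-! ### Comparing powers of the size of the perturbation -/

theorem nonpos_of_le_mul_rpow {c A t : ℝ} (hc : 0 < c)
    (h : ∀ ε : ℝ, 0 < ε → ε ≤ 1 → c ≤ A * ε ^ t) : t ≤ 0 := by
  by_contra! ht
  have h1 : Filter.Tendsto (fun ε : ℝ => A * ε ^ t) (nhdsWithin 0 (Set.Ioi 0)) (nhds (A * 0 ^ t)) :=
    ((Real.continuousAt_rpow_const 0 t (Or.inr ht.le)).tendsto.mono_left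
      nhdsWithin_le_nhds).const_mul A
  rw [Real.zero_rpow ht.ne', mul_zero] at h1
  have h2 : ∀ᶠ ε : ℝ in nhdsWithin 0 (Set.Ioi 0), c ≤ A * ε ^ t := by
    filter_upwards [Ioc_mem_nhdsGT (zero_lt_one' ℝ)] with ε hε
    exact h ε hε.1 hε.2
  exact absurd (ge_of_tendsto h1 h2) (not_le.2 hc)

/-- If there are pairs at distance at least `κ ε` whose images are at distance at most `C ε ^ s`,
and are different with probability at most `C' ε ^ u`, then the lower Hölder exponent is at least
`s + u / p`. -/
theorem LowerHolderInExpectation.add_div_le {X Y P : Type*} [MeasurableSpace P] {p α : ℝ}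
    (hp : 0 < p) (hα : 0 < α) {dX : X → X → ℝ} {dY : Y → Y → ℝ} {μ : Measure P} {f : X → P → Y}
    (h : LowerHolderInExpectation p α dX dY μ f) (hdY : ∀ y y', 0 ≤ dY y y') {κ C C' s u : ℝ}
    (hκ : 0 < κ) (hC : 0 ≤ C) (hC' : 0 ≤ C')
    (hpairs : ∀ ε : ℝ, 0 < ε → ε ≤ 1 → ∃ x x', κ * ε ≤ dX x x' ∧
      (∀ᵐ w ∂μ, dY (f x w) (f x' w) ≤ C * ε ^ s) ∧
      μ {w | dY (f x w) (f x' w) ≠ 0} ≤ ENNReal.ofReal (C' * ε ^ u)) :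
    s + u / p ≤ α := by
  obtain ⟨c, hc, hholder⟩ := h
  have key : ∀ ε : ℝ, 0 < ε → ε ≤ 1 → c ^ p ≤ (C / κ ^ α) ^ p * C' * ε ^ ((s - α) * p + u) := by
    intro ε hε hε1
    obtain ⟨x, x', hd, hbound, hprob⟩ := hpairs ε hε hε1
    have hd0 : 0 < dX x x' := (mul_pos hκ hε).trans_le hd
    have h1 : ∫⁻ w, ENNReal.ofReal ((dY (f x w) (f x' w) / dX x x' ^ α) ^ p) ∂μ ≤
        ∫⁻ w, {w | dY (f x w) (f x' w) ≠ 0}.indicator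
          (fun _ => ENNReal.ofReal ((C * ε ^ s / (κ * ε) ^ α) ^ p)) w ∂μ := by
      refine lintegral_mono_ae ?_
      filter_upwards [hbound] with w hw
      by_cases h0 : dY (f x w) (f x' w) = 0
      · rw [h0, zero_div, Real.zero_rpow hp.ne', ENNReal.ofReal_zero]
        exact zero_le
      · rw [Set.indicator_of_mem (s := {w | dY (f x w) (f x' w) ≠ 0}) h0]
        have := hdY (f x w) (f x' w)
        gcongr
    have h2 := (hholder x x' hd0).trans (h1.trans ((lintegral_indicator_const_le _ _).trans
      (mul_le_mul_right hprob _)))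
    rw [← ENNReal.ofReal_mul (by positivity), ENNReal.ofReal_le_ofReal_iff (by positivity)] at h2
    refine h2.trans (le_of_eq ?_)
    rw [Real.mul_rpow hκ.le hε.le, mul_div_mul_comm, ← Real.rpow_sub hε,
      Real.mul_rpow (by positivity) (by positivity), ← Real.rpow_mul hε.le, Real.rpow_add hε]
    ring
  have h3 := nonpos_of_le_mul_rpow (Real.rpow_pos_of_pos hc p) key
  have h4 : u / p ≤ α - s := by
    rw [div_le_iff₀ hp]
    linarith
  linarith

theorem lpDist_le {ι : Type*} [Fintype ι] {p : ℝ} (hp : 0 < p) {x y : ι → ℝ} {M : ℝ} (hM : 0 ≤ M)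
    (h : ∀ i, |x i - y i| ≤ M) : lpDist p x y ≤ (Fintype.card ι : ℝ) ^ (1 / p) * M := by
  have h1 : ∑ i, |x i - y i| ^ p ≤ Fintype.card ι * M ^ p := by
    refine (Finset.sum_le_card_nsmul _ _ (M ^ p) fun i _ => ?_).trans ?_
    · exact Real.rpow_le_rpow (abs_nonneg _) (h i) hp.le
    · rw [nsmul_eq_mul, Finset.card_univ]
  refine (Real.rpow_le_rpow (Finset.sum_nonneg fun _ _ => Real.rpow_nonneg (abs_nonneg _) _) h1
    (one_div_nonneg.2 hp.le)).trans (le_of_eq ?_)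
  rw [Real.mul_rpow (Nat.cast_nonneg _) (Real.rpow_nonneg hM _), ← Real.rpow_mul hM,
    mul_one_div_cancel hp.ne', Real.rpow_one]

theorem exists_ne_of_lpDist_ne_zero {ι : Type*} [Fintype ι] {p : ℝ} (hp : 0 < p) {x y : ι → ℝ}
    (h : lpDist p x y ≠ 0) : ∃ i, x i - y i ≠ 0 := by
  by_contra! hall
  refine h (le_antisymm ?_ (lpDist_nonneg p x y))
  refine (lpDist_le hp le_rfl fun i => ?_).trans_eq (mul_zero _)
  rw [hall, abs_zero]

/-! ### The lower bounds for the Hölder exponents -/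

theorem mul_eight_add_two_le (K : ℕ) :
    K * 8 + 2 ≤ 1 + 2 * ∑ i ∈ Finset.range (K + 1), 4 ^ i := by
  induction K with
  | zero => simp
  | succ K ih =>
    rw [Finset.sum_range_succ, mul_add]
    have : 4 ≤ 4 ^ (K + 1) := Nat.le_self_pow (by omega) 4
    omega

/-- The layered graphs whose features lie on a segment contained in `Ω`. -/
theorem exists_layered_pair_mem {d K n : ℕ} (hn : K * 8 + 2 ≤ n) {Ω : Set (Vec d)} {x y : Vec d}
    (hseg : segment ℝ x y ⊆ Ω) {ε : ℝ} (hε0 : 0 ≤ ε) (hε1 : ε ≤ 1) (q : Fin 2 → Fin 8) :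
    ∃ G : BoundedGraphs n Ω, G.1 =
      layeredFeatGraph K (x + (1 / 2 : ℝ) • (y - x)) (ε • (1 / 2 : ℝ) • (y - x)) q := by
  refine ⟨⟨layeredFeatGraph K (x + (1 / 2 : ℝ) • (y - x)) (ε • (1 / 2 : ℝ) • (y - x)) q,
    Nat.le_add_left 1 _, hn, fun v => hseg ?_⟩, rfl⟩
  obtain ⟨s, hs, h⟩ := exists_feat_layeredFeatGraph_eq (x + (1 / 2 : ℝ) • (y - x))
    (ε • (1 / 2 : ℝ) • (y - x)) q v
  rw [h, segment_eq_image']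
  obtain ⟨h1, h2⟩ := abs_le.1 hs
  refine ⟨1 / 2 + s * ε * (1 / 2), ⟨?_, ?_⟩, ?_⟩
  · nlinarith
  · nlinarith
  · simp only [smul_smul, add_smul, add_assoc, mul_assoc]

theorem mainTheorem7 (p : ℝ) (hp : 1 ≤ p) (K n : ℕ)
    (hn : 1 + 2 * ∑ i ∈ Finset.range (K + 1), 4 ^ i ≤ n)
    (D W : ℕ → ℕ) (hD : ∀ k, 1 ≤ D k) (hW : ∀ k, 1 ≤ W k)
    (B : ℝ) (hB : 0 < B)
    (Ω : Set (Vec (D 0))) (hΩ : IsCompact Ω)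
    (hseg : ∃ x y : Vec (D 0), x ≠ y ∧ segment ℝ x y ⊆ Ω)
    (z : Vec (D 0)) (hz : z ∉ Ω) :
    (∀ α : ℝ, 0 < α → MPNNLowerHolder p α K n D W B Ω z relu →
      1 + ((K : ℝ) + 1) / p ≤ α) ∧
    (∀ σ : ℝ → ℝ, ContDiff ℝ 2 σ → ∀ α : ℝ, 0 < α →
      MPNNLowerHolder p α K n D W B Ω z σ → (2 : ℝ) ^ (K + 1) ≤ α) := by
  have hp0 : 0 < p := one_pos.trans_le hp
  have hn' : K * 8 + 2 ≤ n := (mul_eight_add_two_le K).trans hn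
  obtain ⟨x, y, hxy, hsub⟩ := hseg
  set x₀ : Vec (D 0) := x + (1 / 2 : ℝ) • (y - x) with hx₀
  set e : Vec (D 0) := (1 / 2 : ℝ) • (y - x) with he
  have he0 : e ≠ 0 := smul_ne_zero (by norm_num) (sub_ne_zero.2 hxy.symm)
  obtain ⟨i, hi⟩ : ∃ i, e i ≠ 0 := by
    by_contra! hall
    exact he0 (PiLp.ext hall)
  have hcoord : ∀ (v : Vec (D 0)) j, |v j| ≤ ‖v‖ := fun v j => PiLp.norm_apply_le v j
  have heps : ∀ ε : ℝ, 0 < ε → ∀ j, |(ε • e) j| ≤ ‖e‖ * ε := by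
    intro ε hε j
    have h1 : |ε * e j| ≤ ‖e‖ * ε := by
      rw [abs_mul, abs_of_pos hε, mul_comm]
      exact mul_le_mul_of_nonneg_right (hcoord e j) hε.le
    exact h1
  have hTMD : ∀ ε : ℝ, 0 < ε → |e i| * ε ≤ TMD p n z K (layeredFeatGraph K x₀ (ε • e) splitTops)
      (layeredFeatGraph K x₀ (ε • e) neutralTops) := by
    intro ε hε
    have h1 : |ε * e i| ≤ TMD p n z K (layeredFeatGraph K x₀ (ε • e) splitTops)
        (layeredFeatGraph K x₀ (ε • e) neutralTops) :=
      le_TMD_layeredFeatGraph hp0 hn' z x₀ (ε • e) i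
    rwa [abs_mul, abs_of_pos hε, mul_comm] at h1
  refine ⟨fun α hα hHolder => ?_, fun σ hσ α hα hHolder => ?_⟩
  · obtain ⟨C, hC0, hC⟩ := exists_preActLin_layerSpread_relu_bound (K := K) (D := D) (W := W)
    refine hHolder.add_div_le hp0 hα (lpDist_nonneg p) (κ := |e i|)
      (C := (Fintype.card (Fin (W K)) : ℝ) ^ (1 / p) * (2 * (C * ‖e‖)))
      (C' := ((∑ k ∈ Finset.range (K + 1), W k : ℕ) * (C * ‖e‖ / B)) ^ (K + 1))
      (abs_pos.2 hi) (by positivity) (by positivity) fun ε hε hε1 => ?_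
    obtain ⟨G, hG⟩ := exists_layered_pair_mem hn' hsub hε.le hε1 splitTops
    obtain ⟨H, hH⟩ := exists_layered_pair_mem hn' hsub hε.le hε1 neutralTops
    have hρ : ∀ (w : MPNNParams K D W) (k : ℕ) (hk : k ≤ K) ab,
        |preActLin ab (layerSpread relu x₀ (ε • e) w k hk)| ≤ C * (‖e‖ * ε) := fun w k hk ab =>
      hC k hk x₀ (ε • e) (‖e‖ * ε) (by positivity) (heps ε hε) w ab
    refine ⟨G, H, ?_, Filter.Eventually.of_forall fun w => ?_, ?_⟩
    · rw [hG, hH]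
      exact hTMD ε hε
    · rw [hG, hH, Real.rpow_one]
      refine (lpDist_le hp0 (M := 2 * (C * (‖e‖ * ε))) (by positivity) fun l => ?_).trans_eq
        (by ring)
      rw [mpnn_sub_mpnn_eq_secDiff]
      refine (abs_secDiff_relu_le _ _).trans ?_
      gcongr
      exact hρ w K le_rfl _
    · refine (measure_mono fun w hw => ?_).trans
        ((mpnnMeasure_kinks_le W hD hB x₀ (ε • e) (C * (‖e‖ * ε))).trans_eq ?_)
      · obtain ⟨l, hl⟩ := exists_ne_of_lpDist_ne_zero hp0 hw
        rw [hG, hH, mpnn_sub_mpnn_eq_secDiff] at hl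
        have hne : layerSpread relu x₀ (ε • e) w K le_rfl ≠ 0 := fun h0 => hl (by
          rw [h0]
          simp [preActLin])
        exact ⟨fun k => exists_preAct_le_of_layerSpread_ne_zero (hρ w) le_rfl hne k k.2,
          l, (abs_le_of_secDiff_relu_ne_zero hl).trans (hρ w K le_rfl _)⟩
      · rw [← ENNReal.ofReal_natCast, ← ENNReal.ofReal_mul (Nat.cast_nonneg _),
          ← ENNReal.ofReal_pow (by positivity)]
        congr 1
        rw [show ((K : ℝ) + 1) = ((K + 1 : ℕ) : ℝ) by push_cast; rfl, Real.rpow_natCast, ← mul_pow]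
        congr 1
        ring
  · obtain ⟨C, hC0, hC⟩ := exists_layerSpread_bound (K := K) (D := D) (W := W) hσ B ‖x₀‖ ‖e‖
      (norm_nonneg e) K
    obtain ⟨M, hM0, hM⟩ := exists_secDiff_layerSpread_bound (K := K) (D := D) (W := W) hσ B ‖x₀‖ ‖e‖
      (norm_nonneg e) K C hC0
    have hprob : ∀ S, mpnnMeasure K D W B S ≤ 1 := by
      have := fun k => isProbabilityMeasure_sumParamsMeasure (hD k) (W k) hB
      have := fun k => isProbabilityMeasure_combineParamsMeasure (hD k) (W k) (D (k + 1))
      have hpr : ∀ k : Fin K, IsProbabilityMeasure ((sumParamsMeasure (D k) (W k) B).prod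
        (combineParamsMeasure (D k) (W k) (D (k + 1)))) := fun k => inferInstance
      have : IsProbabilityMeasure (mpnnMeasure K D W B) := by
        unfold mpnnMeasure
        infer_instance
      exact fun S => prob_le_one
    have := hHolder.add_div_le hp0 hα (lpDist_nonneg p) (κ := |e i|)
      (C := (Fintype.card (Fin (W K)) : ℝ) ^ (1 / p) * M) (C' := 1) (s := (2 : ℝ) ^ (K + 1))
      (u := 0) (abs_pos.2 hi) (by positivity) zero_le_one fun ε hε hε1 => ?_
    · rwa [zero_div, add_zero] at this
    obtain ⟨G, hG⟩ := exists_layered_pair_mem hn' hsub hε.le hε1 splitTops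
    obtain ⟨H, hH⟩ := exists_layered_pair_mem hn' hsub hε.le hε1 neutralTops
    refine ⟨G, H, ?_, ?_, ?_⟩
    · rw [hG, hH]
      exact hTMD ε hε
    · filter_upwards [ae_biasBounded W hD hB] with w hw
      have hpow : ε ^ (2 : ℝ) ^ (K + 1) = ε ^ 2 ^ (K + 1) := by
        rw [← Real.rpow_natCast ε, Nat.cast_pow, Nat.cast_ofNat]
      rw [hG, hH, hpow, mul_assoc]
      refine lpDist_le hp0 (by positivity) fun l => ?_
      rw [mpnn_sub_mpnn_eq_secDiff]
      exact hM le_rfl x₀ (ε • e) ε hε.le hε1 (hcoord x₀) (heps ε hε) w hw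
        (hC le_rfl x₀ (ε • e) ε hε.le hε1 (hcoord x₀) (heps ε hε) w hw) _ (hw.2 l)
    · rw [Real.rpow_zero, mul_one, ENNReal.ofReal_one]
      exact hprob _
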